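/- \textbf{Setting.} Let $N,H\ge 1$ be integers. For $i=1,\dots,N$ let $\mathcal M^i=(\mathcal S^i,\mathcal A^i,H,s_0^i,p^i,r^i)$ be a tabular episodic MDP with finite state and action sets of sizes $S_i,A_i$, initial state $s_0^i$, transition model $p^i_h(\cdot\mid s,a)$ and deterministic reward $r^i_h(s,a)\in[0,1]$, $h=1,\dots,H$, and let $\pi^{E,i}$ be a deterministic, possibly non-Markovian policy for $\mathcal M^i$ (the policy of the expert). A utility is a strictly increasing continuous $U:[0,H]\to[0,H]$ with $U(0)=0$, $U(H)=H$; $\mathfrak U$ is the set of utilities and $\mathfrak U_L$ the set of $L$-Lipschitz ones. Put $J^\pi_i(U)=\mathbb E_{p^i,\pi}\big[U\big(\sum_{h=1}^H r^i_h(s_h,a_h)\big)\big]$, let $J^*_i(U)$ be the maximum of $J^\pi_i(U)$ over all deterministic non-Markovian policies $\pi$, and for real $\Delta$ let $$\mathcal U_\Delta=\Big\{U\in\mathfrak U:\ \sum_{i=1}^N\big(J_i^*(U)-J_i^{\pi^{E,i}}(U)\big)\le\Delta\Big\}.$$ \textbf{Data and algorithm.} For every $i$ we observe $\tau^{E,i}$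 i.i.d. trajectories of $\pi^{E,i}$ in $\mathcal M^i$ and, for every triple $(s,a,h)$, $n_i=\lfloor\tau^i/(S_iA_iH)\rfloor$ i.i.d. samples from $p^i_h(\cdot\mid s,a)$, all independent; $\widehat p^i$ is the empirical transition model. Given $\epsilon_0>0$, let $\mathcal R=\{0,\epsilon_0,\dots,\lfloor1/\epsilon_0\rfloor\epsilon_0\}$ and $\mathcal Y=\{0,\epsilon_0,\dots,\lfloor H/\epsilon_0\rfloor\epsilon_0\}$, and let $\overline r^i_h(s,a)$ be a point of $\mathcal R$ nearest to $r^i_h(s,a)$. The categorical projection of a Dirac mass $\delta_G$ onto $\mathcal Y$ is $\delta_0$ if $G\le0$, is $\delta_{\max\mathcal Y}$ if $G>\max\mathcal Y$, and is $\frac{y+\epsilon_0-G}{\epsilon_0}\delta_y+\frac{G-y}{\epsilon_0}\delta_{y+\epsilon_0}$ if $y<G\le y+\epsilon_0$ with $y,y+\epsilon_0\in\mathcal Y$. CATY, with threshold $\Delta$ and input utility $U$, computes for every $i$: (a) $\widehat\eta^{E,i}$, the average over the $\tau^{E,i}$ expert trajectories of the categorical projections of $\delta_G$, where $G$ is the return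 of the trajectory under $r^i$, and $\widehat J^{E,i}(U)=\sum_{y\in\mathcal Y}\widehat\eta^{E,i}(y)U(y)$; (b) $\widehat J^{*,i}(U)=V_1(s_0^i,0)$, by the backward induction $V_H(s,y)=\max_aU(y+\overline r^i_H(s,a))$ and $V_h(s,y)=\max_a\sum_{s'}\widehat p^i_h(s'\mid s,a)V_{h+1}(s',y+\overline r^i_h(s,a))$ for $h=H-1,\dots,1$. It returns True if $\sum_{i}\big(\widehat J^{*,i}(U)-\widehat J^{E,i}(U)\big)\le\Delta$, and False otherwise. CATY correctly classifies $U$ (for the threshold $\Delta$) if it returns True exactly when $U\in\mathcal U_\Delta$. \textbf{Theorem.} There is an absolute constant $C>0$ such that the following holds in every such setting. Let $L>0$, $\epsilon,\delta\in(0,1)$, and let $\mathcal U\subseteq\mathfrak U_L$. Suppose that for all $i$, in case $|\mathcal U|=1$, $$\tau^{E,i}\ge C\,\frac{N^2H^2}{\epsilon^2}\log\frac{2N}{\delta},\qquad \tau^i\ge C\,\frac{N^2S_iA_iH^4}{\epsilon^2}\log\frac{2S_iA_iHNL}{\delta\epsilon},$$ and otherwise $$\tau^{E,i}\ge C\,\frac{N^4H^4L^2}{\epsilon^4}\log\frac{2HNL}{\delta\epsilon},\qquad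 \tau^i\ge C\,\frac{N^2S_iA_iH^5}{\epsilon^2}\Big(S_i+\log\frac{S_iA_iHN}{\delta}\Big).$$ Then, with $\epsilon_0=\epsilon^2/(72HL^2N^2)$, with probability at least $1-\delta$ the following holds simultaneously for all $\Delta\ge0$ and all $U\in\mathcal U$: if $U\in\mathcal U_{\Delta-\epsilon}$ or $U\notin\mathcal U_{\Delta+\epsilon}$, then CATY with threshold $\Delta$ correctly classifies $U$. -/

import Mathlib

open MeasureTheory

universe u v

noncomputable section

namespace UtilityLearning

/-- The trajectories with `k` completed steps `s₁, a₁, …, sₖ, aₖ, sₖ₊₁`: the state-action pairs of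
the steps, and the current state. -/
abbrev Hist (S : Type u) (A : Type v) (k : ℕ) : Type (max u v) := (Fin k → S × A) × S

/-- A tabular episodic MDP with horizon `H`; stages are numbered from `0` to `H - 1`. -/
structure MDP (S : Type u) (A : Type v) (H : ℕ) where
  /-- initial state -/
  s₀ : S
  /-- transition model -/
  p : Fin H → S → A → PMF S
  /-- deterministic reward -/
  r : Fin H → S → A → ℝ
  r_mem : ∀ h s a, r h s a ∈ Set.Icc (0 : ℝ) 1

/-- Deterministic non-Markovian policies. -/
abbrev Policy (S : Type u) (A : Type v) (H : ℕ) : Type (max u v) :=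
  ∀ h : Fin H, Hist S A (h : ℕ) → A

section Dynamics

variable {S : Type u} {A : Type v} {H : ℕ}

/-- The law of the trajectory after `k` steps when `π` is played in `M`. -/
def histLaw (M : MDP S A H) (π : Policy S A H) : (k : ℕ) → k ≤ H → PMF (Hist S A k)
  | 0, _ => PMF.pure (fun i => i.elim0, M.s₀)
  | k + 1, hk =>
      (histLaw M π k (Nat.le_of_succ_le hk)).bind fun ω =>
        (M.p ⟨k, hk⟩ ω.2 (π ⟨k, hk⟩ ω)).map fun s' =>
          (Fin.snoc (α := fun _ => S × A) ω.1 (ω.2, π ⟨k, hk⟩ ω), s')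

/-- The law of the complete trajectory. -/
def trajLaw (M : MDP S A H) (π : Policy S A H) : PMF (Hist S A H) :=
  histLaw M π H le_rfl

/-- The return of a complete trajectory under the reward `r`. -/
def ret (r : Fin H → S → A → ℝ) (ω : Hist S A H) : ℝ :=
  ∑ h : Fin H, r h (ω.1 h).1 (ω.1 h).2

end Dynamics

/-- Functions from `[0, H]` to `[0, H]`. -/
abbrev Util (H : ℕ) : Type := Set.Icc (0 : ℝ) H → Set.Icc (0 : ℝ) H

/-- The value of `U` at a real number `x`; it is only ever used for `x ∈ [0, H]`, where the
projection onto `[0, H]` does nothing. -/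
def Util.eval {H : ℕ} (U : Util H) (x : ℝ) : ℝ :=
  (U (Set.projIcc 0 (H : ℝ) (Nat.cast_nonneg H) x) : ℝ)

/-- The set of all utilities: strictly increasing continuous functions `U : [0, H] → [0, H]` with
`U 0 = 0` and `U H = H`. -/
def utilities (H : ℕ) : Set (Util H) :=
  {U | U.eval 0 = 0 ∧ U.eval H = H ∧ StrictMono U ∧ Continuous U}

/-- The set of all `L`-Lipschitz utilities. -/
def lipUtilities (H : ℕ) (L : ℝ) : Set (Util H) :=
  {U | U ∈ utilities H ∧
    ∀ x y : Set.Icc (0 : ℝ) H, |(U x : ℝ) - (U y : ℝ)| ≤ L * |(x : ℝ) - (y : ℝ)|}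

section Performance

variable {S : Type u} {A : Type v} {H : ℕ} [Fintype S] [Fintype A]

/-- Expected utility of the return of `π` in `M`. -/
def perf (U : Util H) (M : MDP S A H) (π : Policy S A H) : ℝ :=
  ∑ ω : Hist S A H, (trajLaw M π ω).toReal * U.eval (ret M.r ω)

/-- Optimal expected utility (there are finitely many policies, so the supremum is a maximum). -/
def optPerf (U : Util H) (M : MDP S A H) : ℝ :=
  ⨆ π : Policy S A H, perf U M π

/-- (Non)compatibility of the utility `U` with the policy `πE` in `M`. -/
def noncompat (U : Util H) (M : MDP S A H) (πE : Policy S A H) : ℝ :=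
  optPerf U M - perf U M πE

end Performance

/-- The set of utilities that make the expert's policies, in total, at most `Δ`-suboptimal. -/
def nearFeasible {N H : ℕ} {S : Fin N → Type u} {A : Fin N → Type v}
    [∀ i, Fintype (S i)] [∀ i, Fintype (A i)]
    (M : ∀ i, MDP (S i) (A i) H) (πE : ∀ i, Policy (S i) (A i) H) (Δ : ℝ) : Set (Util H) :=
  {U | U ∈ utilities H ∧ ∑ i, noncompat U (M i) (πE i) ≤ Δ}

/-- The `ε₀`-discretization `{0, ε₀, 2 ε₀, …, ⌊x / ε₀⌋ ε₀}` of the interval `[0, x]`. -/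
def grid (ε₀ x : ℝ) : Finset ℝ :=
  (Finset.range (⌊x / ε₀⌋₊ + 1)).image fun k : ℕ => (k : ℝ) * ε₀

theorem grid_nonempty (ε₀ x : ℝ) : (grid ε₀ x).Nonempty :=
  Finset.Nonempty.image Finset.nonempty_range_add_one _

/-- The projection of `y` onto a finite set of reals: a point of the set at minimal distance
(ties are broken arbitrarily). -/
def nearest (X : Finset ℝ) (hX : X.Nonempty) (y : ℝ) : ℝ :=
  (X.exists_min_image (fun x => |y - x|) hX).choose

/-- The discretized reward: the projection of the reward onto the grid of `[0, 1]`. -/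
def discReward {S : Type u} {A : Type v} {H : ℕ} (ε₀ : ℝ) (r : Fin H → S → A → ℝ) :
    Fin H → S → A → ℝ :=
  fun h s a => nearest (grid ε₀ 1) (grid_nonempty ε₀ 1) (r h s a)

open Classical in
/-- The mass that the categorical projection of the Dirac mass at `G` onto the grid of `[0, x]`
puts on the grid point `y` (the neighbours of `y` in the grid being `y - ε₀` and `y + ε₀`). -/
def catProj (ε₀ x G y : ℝ) : ℝ :=
  if G ≤ 0 then (if y = 0 then 1 else 0)
  else if (⌊x / ε₀⌋₊ : ℝ) * ε₀ < G then (if y = (⌊x / ε₀⌋₊ : ℝ) * ε₀ then 1 else 0)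
  else if y < G ∧ G ≤ y + ε₀ then (y + ε₀ - G) / ε₀
  else if y - ε₀ < G ∧ G ≤ y then (G - (y - ε₀)) / ε₀
  else 0

section Subroutines

variable {S : Type u} {A : Type v} {H : ℕ}

/-- `ERD`: the estimate of the categorical projection of the expert's return distribution computed
from `τ` trajectories; it is a function of the grid point `y`. -/
def erd (ε₀ : ℝ) (r : Fin H → S → A → ℝ) {τ : ℕ} (D : Fin τ → Hist S A H) (y : ℝ) : ℝ :=
  (∑ j, catProj ε₀ H (ret r (D j)) y) / τ

open Classical in
/-- `EXPLORE`: the empirical transition model computed from `n` samples per triple `(h, s, a)`. -/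
def explore {n : ℕ} (X : Fin H × S × A → Fin n → S) (h : Fin H) (s : S) (a : A) (s' : S) : ℝ :=
  (∑ j, if X (h, s, a) j = s' then (1 : ℝ) else 0) / n

/-- The value functions computed by backward induction in `PLANNING`: `planValue p r U k` is the
value function of the stage after which `k` further stages remain, i.e. stage `H - 1 - k` in the
numbering from `0`. Its arguments are the state and the reward accumulated so far. -/
def planValue [Fintype S] (p : Fin H → S → A → S → ℝ) (r : Fin H → S → A → ℝ) (U : Util H) :
    (k : ℕ) → k < H → S → ℝ → ℝ
  | 0, hk, s, y => ⨆ a : A, U.eval (y + r (Fin.rev ⟨0, hk⟩) s a)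
  | k + 1, hk, s, y =>
      ⨆ a : A, ∑ s' : S, p (Fin.rev ⟨k + 1, hk⟩) s a s' *
        planValue p r U k (Nat.lt_of_succ_lt hk) s' (y + r (Fin.rev ⟨k + 1, hk⟩) s a)

/-- `PLANNING`: the optimal value, from the initial state and with no accumulated reward, of the
enlarged state space MDP with transition model `p`, reward `r` and utility `U`. -/
def planning [Fintype S] [NeZero H] (s₀ : S) (p : Fin H → S → A → S → ℝ)
    (r : Fin H → S → A → ℝ) (U : Util H) : ℝ :=
  planValue p r U (H - 1) (Nat.sub_lt (NeZero.pos H) Nat.one_pos) s₀ 0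

end Subroutines

section Algorithm

variable {N H : ℕ} {S : Fin N → Type u} {A : Fin N → Type v}

/-- The estimate of the (non)compatibility of `U` in one environment, computed by `CATY` from the
initial state, the reward, the expert's trajectories and an estimated transition model. -/
def catyEstimate {S : Type u} {A : Type v} {H : ℕ} [Fintype S] [NeZero H] (ε₀ : ℝ) (U : Util H)
    (s₀ : S) (r : Fin H → S → A → ℝ) {τ : ℕ} (D : Fin τ → Hist S A H)
    (p : Fin H → S → A → S → ℝ) : ℝ :=
  planning s₀ p (discReward ε₀ r) U - ∑ y ∈ grid ε₀ H, erd ε₀ r D y * U.eval y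

/-- The output of `CATY` with threshold `Δ` and input utility `U`, as a truth value. -/
def Caty [∀ i, Fintype (S i)] [NeZero H] (ε₀ Δ : ℝ) (U : Util H) (s₀ : ∀ i, S i)
    (r : ∀ i, Fin H → S i → A i → ℝ) {τE : Fin N → ℕ}
    (D : ∀ i, Fin (τE i) → Hist (S i) (A i) H) (p : ∀ i, Fin H → S i → A i → S i → ℝ) : Prop :=
  ∑ i, catyEstimate ε₀ U (s₀ i) (r i) (D i) (p i) ≤ Δ

/-- The random data: for every environment, `τE i` trajectories of the expert, and `n i` samples
of the generative model for every triple `(h, s, a)`. -/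
abbrev Data (H : ℕ) (S : Fin N → Type u) (A : Fin N → Type v) (τE n : Fin N → ℕ) :
    Type (max u v) :=
  (∀ i, Fin (τE i) → Hist (S i) (A i) H) × (∀ i, Fin H × S i × A i → Fin (n i) → S i)

/-- The law of the data: all the trajectories and all the samples are independent, the
trajectories are obtained by executing the expert's policies, and a sample for `(h, s, a)` has law
`p h s a`. -/
def dataLaw [∀ i, Fintype (S i)] [∀ i, Fintype (A i)]
    [∀ i, MeasurableSpace (S i)] [∀ i, MeasurableSpace (A i)]
    (M : ∀ i, MDP (S i) (A i) H) (πE : ∀ i, Policy (S i) (A i) H) (τE n : Fin N → ℕ) :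
    Measure (Data H S A τE n) :=
  (Measure.pi fun i => Measure.pi fun _ : Fin (τE i) => (trajLaw (M i) (πE i)).toMeasure).prod
    (Measure.pi fun i => Measure.pi fun x : Fin H × S i × A i =>
      Measure.pi fun _ : Fin (n i) => ((M i).p x.1 x.2.1 x.2.2).toMeasure)

/-- The number of samples per triple `(h, s, a)` when the budgets are `τ`. -/
def perTriple {N : ℕ} (H : ℕ) (S : Fin N → Type u)
    (A : Fin N → Type v) [∀ i, Fintype (S i)] [∀ i, Fintype (A i)] (τ : Fin N → ℕ) (i : Fin N) :
    ℕ :=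
  τ i / (Fintype.card (S i) * Fintype.card (A i) * H)

end Algorithm

end UtilityLearning

end

open UtilityLearning

/-!
The correct classification of `U` follows as soon as, in every environment, the estimate of the
noncompatibility of `U` has an error of at most `ε / N` (`caty_iff_mem_nearFeasible`). The error has
a deterministic part, due to the discretization: the categorical projection costs `L ε₀`
(`abs_sum_catProj_sub_le`) and rounding the rewards costs `L H ε₀`
(`abs_stageValue_discReward_sub_optPerf_le`, which rests on the optimality of backward induction
among all non-Markovian policies, `optPerf_eq_stageValue`). The rest is statistical, and all of it is
controlled by one concentration inequality, `measure_expect_add_lt_empMean_le`: for a fixed exponent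
`θ`, an empirical mean exceeds the mean by more than `θ * variance + t` with probability at most
`exp (-n θ t)`.

For a single utility `U`, the expert's performance needs this inequality for the one function
`U ∘ ret`. For planning, let `V` be the optimal value function of the true model; it does not depend
on the data, so a union bound over stages, states, actions and grid points gives the inequality for
all its slices, and for their squares. Bounding every variance by `H ^ 2` would cost one factor `H`
too much in the sample size. Instead, `abs_stageValue_sub_add_le` proves by backward induction that
the planning error plus `2 θ V ^ 2` is at most `2 θ H ^ 2` plus lower order terms: along an optimal
action of the true model, the variance of `V` is essentially the expected increment of `V ^ 2`, so
that the variances telescope; along any other action the excess is paid for by the suboptimality of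
that action. Taking `θ` of the order of `ε / (N H ^ 2)` makes the bound a fraction of `ε / N`.

For a set of utilities, the data must serve all of them at once. A utility is increasing, so up to
`L ε₀` it is a combination, with nonnegative coefficients of sum at most `H`, of indicators of the
events that the return reaches a grid point; it suffices to estimate the probabilities of these
events (`abs_expect_eval_sub_le`). For the transition models it suffices to estimate the
probabilities of all subsets of the state space (`abs_expect_sub_le_of_sum_le`), and the errors add
up over the stages (`abs_stageValue_sub_le_of_transition`).
-/

namespace UtilityLearning

/-! ### Finite expectations -/

section Expectation

variable {Ω : Type*} [Fintype Ω]

/-- The expectation of `f` under the weights `q`. -/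
noncomputable def expect (q f : Ω → ℝ) : ℝ := ∑ x, q x * f x

/-- The variance of `f` under the weights `q`. -/
noncomputable def var (q f : Ω → ℝ) : ℝ := expect q fun x => (f x - expect q f) ^ 2

variable {q : Ω → ℝ} {f g : Ω → ℝ}

theorem expect_add (q f g : Ω → ℝ) : expect q (fun x => f x + g x) = expect q f + expect q g := by
  simp [expect, mul_add, Finset.sum_add_distrib]

theorem expect_sub (q f g : Ω → ℝ) : expect q (fun x => f x - g x) = expect q f - expect q g := by
  simp [expect, mul_sub, Finset.sum_sub_distrib]

theorem expect_neg (q f : Ω → ℝ) : expect q (fun x => -f x) = -expect q f := by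
  simp [expect]

theorem expect_const_mul (q f : Ω → ℝ) (c : ℝ) :
    expect q (fun x => c * f x) = c * expect q f := by
  simp only [expect, Finset.mul_sum]
  exact Finset.sum_congr rfl fun x _ => by ring

theorem expect_mul_const (q f : Ω → ℝ) (c : ℝ) :
    expect q (fun x => f x * c) = expect q f * c := by
  simp only [mul_comm _ c, expect_const_mul]

theorem expect_sum {ι : Type*} (s : Finset ι) (q : Ω → ℝ) (F : ι → Ω → ℝ) :
    expect q (fun x => ∑ i ∈ s, F i x) = ∑ i ∈ s, expect q (F i) := by
  simp only [expect, Finset.mul_sum]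
  exact Finset.sum_comm

theorem expect_const (hq : q ∈ stdSimplex ℝ Ω) (c : ℝ) : expect q (fun _ => c) = c := by
  simp [expect, ← Finset.sum_mul, hq.2]

theorem expect_mono (hq : q ∈ stdSimplex ℝ Ω) (h : ∀ x, f x ≤ g x) : expect q f ≤ expect q g :=
  Finset.sum_le_sum fun x _ => mul_le_mul_of_nonneg_left (h x) (hq.1 x)

theorem expect_mem_Icc (hq : q ∈ stdSimplex ℝ Ω) {a b : ℝ} (h : ∀ x, f x ∈ Set.Icc a b) :
    expect q f ∈ Set.Icc a b :=
  ⟨(expect_const hq a).symm.le.trans (expect_mono hq fun x => (h x).1),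
    (expect_mono hq fun x => (h x).2).trans (expect_const hq b).le⟩

theorem abs_expect_sub_le (hq : q ∈ stdSimplex ℝ Ω) {c : ℝ} (h : ∀ x, |f x - g x| ≤ c) :
    |expect q f - expect q g| ≤ c := by
  rw [← expect_sub, abs_le]
  exact expect_mem_Icc hq fun x => abs_le.1 (h x)

theorem var_eq (hq : q ∈ stdSimplex ℝ Ω) (f : Ω → ℝ) :
    var q f = expect q (fun x => f x ^ 2) - expect q f ^ 2 := by
  have h : (fun x => (f x - expect q f) ^ 2) =
      fun x => f x ^ 2 - (f x * (2 * expect q f) - expect q f ^ 2) := by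
    funext x; ring
  rw [var, h, expect_sub, expect_sub, expect_mul_const, expect_const hq]
  ring

theorem var_neg (q f : Ω → ℝ) : var q (fun x => -f x) = var q f := by
  unfold var
  rw [expect_neg]
  congr 1
  funext x
  ring

theorem var_le_of_mem_Icc (hq : q ∈ stdSimplex ℝ Ω) {B : ℝ} (h : ∀ x, f x ∈ Set.Icc 0 B) :
    var q f ≤ B ^ 2 := by
  rw [var_eq hq]
  have h1 : expect q (fun x => f x ^ 2) ≤ expect q (fun _ => B ^ 2) :=
    expect_mono hq fun x => pow_le_pow_left₀ (h x).1 (h x).2 2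
  rw [expect_const hq] at h1
  nlinarith [sq_nonneg (expect q f)]

/-- The square of a function with values in `[0, B]` varies at most `2 B` times as much as the
function. -/
theorem var_sq_le (hq : q ∈ stdSimplex ℝ Ω) {B : ℝ} (h : ∀ x, f x ∈ Set.Icc 0 B) :
    var q (fun x => f x ^ 2) ≤ 4 * B ^ 2 * var q f := by
  have hm := expect_mem_Icc hq h
  set m := expect q f with hmdef
  -- the second moment about `m ^ 2` is at least the variance
  have h1 : var q (fun x => f x ^ 2) ≤ expect q fun x => (f x ^ 2 - m ^ 2) ^ 2 := by
    have h2 : expect q (fun x => (f x ^ 2 - m ^ 2) ^ 2) =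
        expect q (fun x => (f x ^ 2) ^ 2) - 2 * m ^ 2 * expect q (fun x => f x ^ 2) + m ^ 4 := by
      have : (fun x => (f x ^ 2 - m ^ 2) ^ 2) =
          fun x => (f x ^ 2) ^ 2 - (2 * m ^ 2 * f x ^ 2 - m ^ 4) := by
        funext x; ring
      rw [this, expect_sub, expect_sub, expect_const_mul, expect_const hq]
      ring
    rw [var_eq hq, h2]
    nlinarith [sq_nonneg (expect q (fun x => f x ^ 2) - m ^ 2)]
  refine h1.trans ?_
  rw [var, ← expect_const_mul]
  refine expect_mono hq fun x => ?_
  have h3 : (f x + m) ^ 2 ≤ (2 * B) ^ 2 :=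
    pow_le_pow_left₀ (add_nonneg (h x).1 hm.1) (by linarith [(h x).2, hm.2]) 2
  calc (f x ^ 2 - m ^ 2) ^ 2 = (f x + m) ^ 2 * (f x - m) ^ 2 := by ring
    _ ≤ (2 * B) ^ 2 * (f x - m) ^ 2 := mul_le_mul_of_nonneg_right h3 (sq_nonneg _)
    _ = 4 * B ^ 2 * (f x - m) ^ 2 := by ring

/-- Two distributions that are close on events are close on bounded functions. -/
theorem abs_expect_sub_le_of_sum_le {p : Ω → ℝ} (hp : p ∈ stdSimplex ℝ Ω)
    (hq : q ∈ stdSimplex ℝ Ω) {β B : ℝ} (hB : 0 ≤ B)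
    (h : ∀ T : Finset Ω, ∑ x ∈ T, q x ≤ ∑ x ∈ T, p x + β) (hf : ∀ x, f x ∈ Set.Icc 0 B) :
    |expect q f - expect p f| ≤ B * β := by
  classical
  have key : ∀ g : Ω → ℝ, (∀ x, g x ∈ Set.Icc 0 B) → expect q g - expect p g ≤ B * β := by
    intro g hg
    let T : Finset Ω := Finset.univ.filter fun x => p x ≤ q x
    have h1 : expect q g - expect p g = ∑ x, (q x - p x) * g x := by
      simp only [expect, ← Finset.sum_sub_distrib, sub_mul]
    have h2 : ∑ x, (q x - p x) * g x ≤ ∑ x ∈ T, (q x - p x) * B := by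
      rw [Finset.sum_filter]
      refine Finset.sum_le_sum fun x _ => ?_
      split_ifs with hx
      · exact mul_le_mul_of_nonneg_left (hg x).2 (sub_nonneg.2 hx)
      · exact mul_nonpos_of_nonpos_of_nonneg (by linarith) (hg x).1
    have h3 := h T
    rw [h1]
    refine h2.trans ?_
    rw [← Finset.sum_mul, Finset.sum_sub_distrib, mul_comm]
    exact mul_le_mul_of_nonneg_left (by linarith) hB
  rw [abs_le]
  refine ⟨?_, key f hf⟩
  have h1 := key (fun x => B - f x) fun x => ⟨by linarith [(hf x).2], by linarith [(hf x).1]⟩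
  rw [expect_sub, expect_sub, expect_const hp, expect_const hq] at h1
  linarith

end Expectation

section Weights

variable {Ω Ω' : Type*} [Fintype Ω] [Fintype Ω']

/-- The point masses of a `PMF`, as real numbers. -/
noncomputable def wt (p : PMF Ω) (x : Ω) : ℝ := (p x).toReal

theorem wt_mem_stdSimplex (p : PMF Ω) : wt p ∈ stdSimplex ℝ Ω := by
  refine ⟨fun x => ENNReal.toReal_nonneg, ?_⟩
  have h := p.tsum_coe
  rw [tsum_fintype] at h
  simp only [wt]
  rw [← ENNReal.toReal_sum fun x _ => p.apply_ne_top x, h, ENNReal.toReal_one]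

theorem expect_wt_pure (a : Ω) (f : Ω → ℝ) : expect (wt (PMF.pure a)) f = f a := by
  classical
  rw [expect, Finset.sum_eq_single a]
  · simp [wt]
  · intro b _ hb
    simp [wt, hb]
  · simp

theorem expect_wt_bind (p : PMF Ω) (k : Ω → PMF Ω') (f : Ω' → ℝ) :
    expect (wt (p.bind k)) f = expect (wt p) fun x => expect (wt (k x)) f := by
  have h : ∀ y, wt (p.bind k) y = ∑ x, wt p x * wt (k x) y := by
    intro y
    simp only [wt, PMF.bind_apply, tsum_fintype]
    rw [ENNReal.toReal_sum fun x _ => ENNReal.mul_ne_top (p.apply_ne_top x) ((k x).apply_ne_top y)]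
    simp [ENNReal.toReal_mul]
  simp only [expect, h, Finset.sum_mul, Finset.mul_sum]
  rw [Finset.sum_comm]
  exact Finset.sum_congr rfl fun x _ => Finset.sum_congr rfl fun y _ => by ring

theorem expect_wt_map (p : PMF Ω) (φ : Ω → Ω') (f : Ω' → ℝ) :
    expect (wt (p.map φ)) f = expect (wt p) fun x => f (φ x) := by
  rw [PMF.map, expect_wt_bind]
  simp [expect_wt_pure]

end Weights

/-! ### Concentration of empirical means -/

section Concentration

variable {Ω : Type*}

/-- The average of `f` over a sample. -/
noncomputable def empMean {n : ℕ} (x : Fin n → Ω) (f : Ω → ℝ) : ℝ := (∑ j, f (x j)) / n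

variable [Fintype Ω]

/-- The moment generating function, from `exp x ≤ 1 + x + x²` for `|x| ≤ 1`. -/
theorem expect_exp_le {q f : Ω → ℝ} (hq : q ∈ stdSimplex ℝ Ω) {θ : ℝ}
    (hf : ∀ x, |θ * (f x - expect q f)| ≤ 1) :
    expect q (fun x => Real.exp (θ * (f x - expect q f))) ≤ Real.exp (θ ^ 2 * var q f) := by
  have h1 : expect q (fun x => Real.exp (θ * (f x - expect q f))) ≤
      expect q (fun x => 1 + (θ * (f x - expect q f) + θ ^ 2 * (f x - expect q f) ^ 2)) := by
    refine expect_mono hq fun x => ?_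
    have := (abs_le.1 (Real.abs_exp_sub_one_sub_id_le (hf x))).2
    nlinarith
  refine h1.trans ?_
  rw [expect_add, expect_add, expect_const_mul, expect_const_mul, expect_sub, expect_const hq,
    expect_const hq]
  have := Real.add_one_le_exp (θ ^ 2 * var q f)
  unfold var at this ⊢
  linarith

/-- Bernstein's inequality with the variance term linearized: a fixed exponent `θ` in the
exponential Markov inequality gives the deviation `θ * var + t` instead of the square root of the
variance. -/
theorem measure_expect_add_lt_empMean_le [MeasurableSpace Ω] [DiscreteMeasurableSpace Ω]
    (p : PMF Ω) (f : Ω → ℝ) {θ t : ℝ} (hθ : 0 < θ)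
    (hf : ∀ x, |θ * (f x - expect (wt p) f)| ≤ 1) (n : ℕ) :
    (Measure.pi fun _ : Fin n => p.toMeasure)
        {x | expect (wt p) f + θ * var (wt p) f + t < empMean x f} ≤
      ENNReal.ofReal (Real.exp (-(n * (θ * t)))) := by
  set μ := Measure.pi fun _ : Fin n => p.toMeasure with hμ
  rcases Nat.eq_zero_or_pos n with rfl | hn
  · simpa using prob_le_one
  have hn' : (0 : ℝ) < n := by exact_mod_cast hn
  set m := expect (wt p) f with hm
  set v := var (wt p) f with hv
  let F : (Fin n → Ω) → ℝ := fun x => ∏ j, Real.exp (θ * (f (x j) - m))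
  have hint : Integrable F μ := Integrable.of_finite
  have hF : ∫ x, F x ∂μ ≤ Real.exp (n * (θ ^ 2 * v)) := by
    rw [hμ, integral_fintype_prod_eq_pow (fun x => Real.exp (θ * (f x - m))), PMF.integral_eq_sum,
      Real.exp_nat_mul, Fintype.card_fin]
    refine pow_le_pow_left₀ ?_ ?_ n
    · exact Finset.sum_nonneg fun x _ => smul_nonneg ENNReal.toReal_nonneg (Real.exp_pos _).le
    · exact expect_exp_le (wt_mem_stdSimplex p) hf
  have hsub : {x | m + θ * v + t < empMean x f} ⊆
      {x | Real.exp (n * (θ * (θ * v + t))) ≤ F x} := by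
    intro x hx
    simp only [Set.mem_ofPred_eq, empMean, lt_div_iff₀ hn'] at hx ⊢
    simp only [F]
    rw [← Real.exp_sum, Real.exp_le_exp, ← Finset.mul_sum, Finset.sum_sub_distrib]
    simp only [Finset.sum_const, Finset.card_univ, Fintype.card_fin, nsmul_eq_mul]
    nlinarith
  have hmarkov := mul_meas_ge_le_integral_of_nonneg
    (Filter.Eventually.of_forall fun x => Finset.prod_nonneg fun j _ => (Real.exp_pos _).le)
    hint (Real.exp (n * (θ * (θ * v + t))))
  have hreal : μ.real {x | m + θ * v + t < empMean x f} ≤ Real.exp (-(n * (θ * t))) := by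
    refine (measureReal_mono hsub).trans ?_
    have h2 : Real.exp (n * (θ * (θ * v + t))) *
        μ.real {x | Real.exp (n * (θ * (θ * v + t))) ≤ F x} ≤
        Real.exp (n * (θ * (θ * v + t))) * Real.exp (-(n * (θ * t))) := by
      rw [← Real.exp_add]
      refine (hmarkov.trans hF).trans (le_of_eq ?_)
      congr 1
      ring
    exact le_of_mul_le_mul_left h2 (Real.exp_pos _)
  rw [← ofReal_measureReal]
  exact ENNReal.ofReal_le_ofReal hreal

end Concentration

/-! ### Utilities as functions on the real line -/

section Utilities

variable {H : ℕ} {U : Util H} {L : ℝ}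

theorem Util.eval_mem_Icc (U : Util H) (x : ℝ) : U.eval x ∈ Set.Icc (0 : ℝ) H := (U _).2

theorem Util.eval_mono (hU : StrictMono U) : Monotone U.eval := fun _ _ hxy =>
  hU.monotone (Set.monotone_projIcc _ hxy)

theorem Util.abs_eval_sub_le (hL : 0 ≤ L) (hU : U ∈ lipUtilities H L) (x y : ℝ) :
    |U.eval x - U.eval y| ≤ L * |x - y| := by
  refine (hU.2 _ _).trans (mul_le_mul_of_nonneg_left ?_ hL)
  have := (LipschitzWith.projIcc (Nat.cast_nonneg (α := ℝ) H)).dist_le_mul x y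
  simpa [Real.dist_eq, Subtype.dist_eq] using this

/-- A Lipschitz function that maps `0` to `0` and `H` to `H` has a Lipschitz constant of at least
one. -/
theorem one_le_of_mem_lipUtilities [NeZero H] (hL : 0 ≤ L) (hU : U ∈ lipUtilities H L) :
    1 ≤ L := by
  have hH : (0 : ℝ) < H := by exact_mod_cast NeZero.pos H
  have h := Util.abs_eval_sub_le hL hU H 0
  rw [hU.1.1, hU.1.2.1, sub_zero, abs_of_pos hH] at h
  exact le_of_mul_le_mul_right (by linarith) hH

end Utilities

/-! ### Dynamic programming on the enlarged state space -/

theorem abs_ciSup_sub_ciSup_le {ι : Type*} [Finite ι] [Nonempty ι] {f g : ι → ℝ} {c : ℝ}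
    (h : ∀ a, |f a - g a| ≤ c) : |(⨆ a, f a) - ⨆ a, g a| ≤ c := by
  have key : ∀ f g : ι → ℝ, (∀ a, |f a - g a| ≤ c) → (⨆ a, f a) ≤ (⨆ a, g a) + c := by
    intro f g h
    refine ciSup_le fun a => ?_
    have := le_ciSup (Set.finite_range g).bddAbove a
    linarith [(abs_le.1 (h a)).2]
  rw [abs_le]
  constructor
  · linarith [key g f fun a => by rw [abs_sub_comm]; exact h a]
  · linarith [key f g h]

section Planning

variable {S : Type u} {A : Type v} {H : ℕ} [Fintype S]

/-- The optimal value when `j` stages remain, in state `s` with accumulated reward `y`: the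
reward of a run is the utility of the total accumulated reward, paid at the end. -/
noncomputable def stageValue (p : Fin H → S → A → S → ℝ) (r : Fin H → S → A → ℝ) (U : Util H) :
    (j : ℕ) → j ≤ H → S → ℝ → ℝ
  | 0, _, _, y => U.eval y
  | j + 1, hj, s, y =>
      ⨆ a : A, expect (p (Fin.rev ⟨j, hj⟩) s a) fun s' =>
        stageValue p r U j (Nat.le_of_succ_le hj) s' (y + r (Fin.rev ⟨j, hj⟩) s a)

variable {p : Fin H → S → A → S → ℝ} {r : Fin H → S → A → ℝ} {U : Util H}

theorem planValue_eq_stageValue (hp : ∀ h s a, p h s a ∈ stdSimplex ℝ S) (k : ℕ) (hk : k < H)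
    (s : S) (y : ℝ) : planValue p r U k hk s y = stageValue p r U (k + 1) hk s y := by
  induction k generalizing s y with
  | zero => simp only [planValue, stageValue, expect_const (hp _ _ _)]
  | succ k ih =>
    rw [planValue, stageValue]
    simp only [ih, expect]

theorem planning_eq_stageValue [NeZero H] (hp : ∀ h s a, p h s a ∈ stdSimplex ℝ S) (s₀ : S) :
    planning s₀ p r U = stageValue p r U H le_rfl s₀ 0 := by
  rw [planning, planValue_eq_stageValue hp]
  have h : H - 1 + 1 = H := Nat.sub_add_cancel (NeZero.pos H)
  congr 1

/-- The deviations of `q` from `p` on a function `f` that the planning error bound needs: first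
order deviations up to `t` plus a multiple of the variance of `f`, and a bound from below for the
second moment of `f`. -/
structure VarClose (p q : S → ℝ) (θ t t' : ℝ) (f : S → ℝ) : Prop where
  le_add : expect q f ≤ expect p f + θ * var p f + t
  ge_sub : expect p f ≤ expect q f + θ * var p f + t
  sq_le : expect p (fun x => f x ^ 2) ≤ expect q (fun x => f x ^ 2) + var p f / 2 + t'

/-- The variance under the true model in terms of the second moment under the empirical one, which
is the increment of the potential in the induction over the stages. -/
theorem VarClose.var_le {p q : S → ℝ} {θ t t' : ℝ} {f : S → ℝ} (hp : p ∈ stdSimplex ℝ S)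
    (h : VarClose p q θ t t' f) :
    var p f ≤ 2 * (expect q (fun x => f x ^ 2) - expect p f ^ 2 + t') := by
  have h1 := h.sq_le
  have h2 := var_eq hp f
  linarith

variable [Nonempty A]

theorem stageValue_mem_Icc (hp : ∀ h s a, p h s a ∈ stdSimplex ℝ S) (j : ℕ) (hj : j ≤ H) (s : S)
    (y : ℝ) : stageValue p r U j hj s y ∈ Set.Icc (0 : ℝ) H := by
  induction j generalizing s y with
  | zero => exact U.eval_mem_Icc y
  | succ j ih =>
    have h : ∀ a : A, expect (p (Fin.rev ⟨j, hj⟩) s a) (fun s' =>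
        stageValue p r U j (Nat.le_of_succ_le hj) s' (y + r (Fin.rev ⟨j, hj⟩) s a)) ∈
        Set.Icc (0 : ℝ) H := fun a => expect_mem_Icc (hp _ _ _) fun s' => ih _ _ _
    exact ⟨Real.iSup_nonneg fun a => (h a).1, ciSup_le fun a => (h a).2⟩

variable [Finite A]

/-- The value depends continuously on the rewards, for a Lipschitz utility. -/
theorem abs_stageValue_sub_le_of_reward (hp : ∀ h s a, p h s a ∈ stdSimplex ℝ S)
    {r' : Fin H → S → A → ℝ} {L ρ : ℝ} (hL : 0 ≤ L) (hU : U ∈ lipUtilities H L)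
    (hr : ∀ h s a, |r h s a - r' h s a| ≤ ρ) (j : ℕ) (hj : j ≤ H) (s : S) (y y' : ℝ) :
    |stageValue p r U j hj s y - stageValue p r' U j hj s y'| ≤ L * (|y - y'| + j * ρ) := by
  induction j generalizing s y y' with
  | zero => simpa [stageValue] using Util.abs_eval_sub_le hL hU y y'
  | succ j ih =>
    refine abs_ciSup_sub_ciSup_le fun a => abs_expect_sub_le (hp _ _ _) fun s' =>
      (ih _ s' _ _).trans (mul_le_mul_of_nonneg_left ?_ hL)
    have h1 := hr (Fin.rev ⟨j, hj⟩) s a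
    have h2 := abs_add_le (y - y') (r (Fin.rev ⟨j, hj⟩) s a - r' (Fin.rev ⟨j, hj⟩) s a)
    rw [add_sub_add_comm]
    push_cast
    linarith

/-- If the two transition models give nearby expectations to all functions with values in
`[0, H]`, then the errors add up over the stages. -/
theorem abs_stageValue_sub_le_of_transition {q : Fin H → S → A → S → ℝ}
    (hp : ∀ h s a, p h s a ∈ stdSimplex ℝ S) (hq : ∀ h s a, q h s a ∈ stdSimplex ℝ S) {β : ℝ}
    (h : ∀ h s a, ∀ f : S → ℝ, (∀ x, f x ∈ Set.Icc (0 : ℝ) H) →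
      |expect (q h s a) f - expect (p h s a) f| ≤ β) (j : ℕ) (hj : j ≤ H) (s : S) (y : ℝ) :
    |stageValue q r U j hj s y - stageValue p r U j hj s y| ≤ j * β := by
  induction j generalizing s y with
  | zero => simp [stageValue]
  | succ j ih =>
    refine abs_ciSup_sub_ciSup_le fun a => ?_
    have h1 := abs_expect_sub_le (hq (Fin.rev ⟨j, hj⟩) s a) fun s' =>
      ih (Nat.le_of_succ_le hj) s' (y + r (Fin.rev ⟨j, hj⟩) s a)
    have h2 := h (Fin.rev ⟨j, hj⟩) s a _ fun s' => stageValue_mem_Icc (r := r) (U := U) hp j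
      (Nat.le_of_succ_le hj) s' (y + r (Fin.rev ⟨j, hj⟩) s a)
    have h3 := abs_sub_le
      (expect (q (Fin.rev ⟨j, hj⟩) s a) fun s' =>
        stageValue q r U j (Nat.le_of_succ_le hj) s' (y + r (Fin.rev ⟨j, hj⟩) s a))
      (expect (q (Fin.rev ⟨j, hj⟩) s a) fun s' =>
        stageValue p r U j (Nat.le_of_succ_le hj) s' (y + r (Fin.rev ⟨j, hj⟩) s a))
      (expect (p (Fin.rev ⟨j, hj⟩) s a) fun s' =>
        stageValue p r U j (Nat.le_of_succ_le hj) s' (y + r (Fin.rev ⟨j, hj⟩) s a))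
    push_cast
    linarith

/-- Planning with the model `q` in place of `p`: the potential `2 θ V²`, where `V` is the optimal
value under `p`, absorbs the variances of `V` that the deviations of `q` from `p` contribute. So
these add up to `2 θ H²` instead of the `θ H³` that bounding every variance by `H²` would give.
The set `Y j` contains the rewards that can be accumulated when `j` stages remain. -/
theorem abs_stageValue_sub_add_le {q : Fin H → S → A → S → ℝ}
    (hp : ∀ h s a, p h s a ∈ stdSimplex ℝ S) (hq : ∀ h s a, q h s a ∈ stdSimplex ℝ S)
    {θ t t' : ℝ} (hθ : 0 ≤ θ) (hθH : 4 * θ * H ≤ 1) (Y : ℕ → Set ℝ)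
    (hY : ∀ (j : ℕ) (hj : j < H) (s : S) (a : A), ∀ y ∈ Y (j + 1),
      y + r (Fin.rev ⟨j, hj⟩) s a ∈ Y j)
    (h : ∀ (j : ℕ) (hj : j < H) (s : S) (a : A), ∀ y ∈ Y j,
      VarClose (p (Fin.rev ⟨j, hj⟩) s a) (q (Fin.rev ⟨j, hj⟩) s a) θ t t'
        fun s' => stageValue p r U j hj.le s' y)
    (j : ℕ) (hj : j ≤ H) (s : S) (y : ℝ) (hy : y ∈ Y j) :
    |stageValue q r U j hj s y - stageValue p r U j hj s y| +
      2 * θ * stageValue p r U j hj s y ^ 2 ≤ 2 * θ * H ^ 2 + j * (t + 2 * θ * t') := by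
  induction j generalizing s y with
  | zero =>
    have h1 := U.eval_mem_Icc y
    have h2 := pow_le_pow_left₀ h1.1 h1.2 2
    simp only [stageValue, sub_self, abs_zero, Nat.cast_zero, zero_mul, zero_add, add_zero]
    exact mul_le_mul_of_nonneg_left h2 (by linarith)
  | succ j ih =>
    set c : ℝ := 2 * θ * H ^ 2 + j * (t + 2 * θ * t') with hc
    set hh : Fin H := Fin.rev ⟨j, hj⟩ with hhdef
    have hj' : j ≤ H := Nat.le_of_succ_le hj
    let f : A → S → ℝ := fun a s' => stageValue p r U j hj' s' (y + r hh s a)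
    let g : A → S → ℝ := fun a s' => stageValue q r U j hj' s' (y + r hh s a)
    have hVp : stageValue p r U (j + 1) hj s y = ⨆ a, expect (p hh s a) (f a) := rfl
    have hVq : stageValue q r U (j + 1) hj s y = ⨆ a, expect (q hh s a) (g a) := rfl
    have hV := stageValue_mem_Icc (r := r) (U := U) hp (j + 1) hj s y
    rw [hVp] at hV ⊢
    rw [hVq]
    set V := ⨆ a, expect (p hh s a) (f a) with hVdef
    have hpV : ∀ a, expect (p hh s a) (f a) ∈ Set.Icc 0 V := fun a =>
      ⟨(expect_mem_Icc (hp _ _ _) fun s' => stageValue_mem_Icc hp j hj' s' _).1,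
        le_ciSup (Set.finite_range fun a => expect (p hh s a) (f a)).bddAbove a⟩
    have hfg : ∀ a s', |g a s' - f a s'| + 2 * θ * f a s' ^ 2 ≤ c := fun a s' =>
      ih hj' s' _ (hY j hj s a y hy)
    have hcl : ∀ a, VarClose (p hh s a) (q hh s a) θ t t' (f a) := fun a =>
      h j hj s a _ (hY j hj s a y hy)
    have hvar : ∀ a, θ * var (p hh s a) (f a) ≤
        2 * θ * (expect (q hh s a) (fun x => f a x ^ 2) - expect (p hh s a) (f a) ^ 2 + t') :=
      fun a => by
        have := mul_le_mul_of_nonneg_left ((hcl a).var_le (hp _ _ _)) hθ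
        linarith
    have hupper : (⨆ a, expect (q hh s a) (g a)) ≤ V - 2 * θ * V ^ 2 + c + t + 2 * θ * t' := by
      refine ciSup_le fun a => ?_
      have h1 : expect (q hh s a) (g a) ≤
          expect (q hh s a) fun x => f a x + (c - 2 * θ * f a x ^ 2) :=
        expect_mono (hq _ _ _) fun s' => by linarith [hfg a s', le_abs_self (g a s' - f a s')]
      rw [expect_add, expect_sub, expect_const (hq _ _ _), expect_const_mul] at h1
      have h2 := (hcl a).le_add
      have h3 := hvar a
      have h4 := hpV a
      -- `x - 2 θ x²` is increasing on `[0, H]` because `4 θ H ≤ 1`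
      have h5 : expect (p hh s a) (f a) - 2 * θ * expect (p hh s a) (f a) ^ 2 ≤
          V - 2 * θ * V ^ 2 := by
        have h6 : 2 * θ * (V + expect (p hh s a) (f a)) ≤ 1 := by
          have : 2 * θ * (V + expect (p hh s a) (f a)) ≤ 2 * θ * (H + H) :=
            mul_le_mul_of_nonneg_left (by linarith [h4.2, hV.2]) (by linarith)
          linarith
        nlinarith [mul_nonneg (sub_nonneg.2 h4.2) (sub_nonneg.2 h6)]
      linarith
    have hlower : V + 2 * θ * V ^ 2 - c - t - 2 * θ * t' ≤ ⨆ a, expect (q hh s a) (g a) := by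
      obtain ⟨a, ha⟩ := exists_eq_ciSup_of_finite (f := fun a => expect (p hh s a) (f a))
      refine le_trans ?_ (le_ciSup (Set.finite_range fun a => expect (q hh s a) (g a)).bddAbove a)
      have h1 : expect (q hh s a) (fun x => f a x + (2 * θ * f a x ^ 2 - c)) ≤
          expect (q hh s a) (g a) :=
        expect_mono (hq _ _ _) fun s' => by linarith [hfg a s', neg_abs_le (g a s' - f a s')]
      rw [expect_add, expect_sub, expect_const (hq _ _ _), expect_const_mul] at h1
      have h2 := (hcl a).ge_sub
      have h3 := hvar a
      have ha' : expect (p hh s a) (f a) = V := ha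
      rw [ha'] at h2 h3
      linarith
    push_cast
    rw [← le_sub_iff_add_le, abs_le]
    constructor <;> linarith

end Planning

/-! ### Optimality of backward induction among non-Markovian policies -/

section Optimality

variable {S : Type u} {A : Type v} {H : ℕ}

/-- The reward accumulated along a trajectory with `k` completed steps. -/
noncomputable def partialRet (r : Fin H → S → A → ℝ) {k : ℕ} (hk : k ≤ H) (ω : Hist S A k) : ℝ :=
  ∑ i : Fin k, r (Fin.castLE hk i) (ω.1 i).1 (ω.1 i).2

theorem partialRet_snoc (r : Fin H → S → A → ℝ) {k : ℕ} (hk : k + 1 ≤ H) (ω : Hist S A k) (a : A)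
    (s' : S) :
    partialRet r hk (Fin.snoc (α := fun _ => S × A) ω.1 (ω.2, a), s') =
      partialRet r (Nat.le_of_succ_le hk) ω + r ⟨k, hk⟩ ω.2 a := by
  simp only [partialRet, Fin.sum_univ_castSucc, Fin.snoc_castSucc, Fin.snoc_last]
  rfl

variable [Fintype S] [Fintype A]

/-- The expectation, after `k` steps of `π`, of the optimal value of the remaining `j` stages. -/
noncomputable def stagePerf (U : Util H) (M : MDP S A H) (π : Policy S A H) (k j : ℕ) (hk : k ≤ H)
    (hj : j ≤ H) : ℝ :=
  expect (wt (histLaw M π k hk)) fun ω =>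
    stageValue (fun h s a => wt (M.p h s a)) M.r U j hj ω.2 (partialRet M.r hk ω)

theorem stagePerf_succ (U : Util H) (M : MDP S A H) (π : Policy S A H) (k j : ℕ)
    (hk : k + 1 ≤ H) (hj : j ≤ H) :
    stagePerf U M π (k + 1) j hk hj =
      expect (wt (histLaw M π k (Nat.le_of_succ_le hk))) fun ω =>
        expect (wt (M.p ⟨k, hk⟩ ω.2 (π ⟨k, hk⟩ ω))) fun s' =>
          stageValue (fun h s a => wt (M.p h s a)) M.r U j hj s'
            (partialRet M.r (Nat.le_of_succ_le hk) ω + M.r ⟨k, hk⟩ ω.2 (π ⟨k, hk⟩ ω)) := by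
  rw [stagePerf, histLaw, expect_wt_bind]
  simp only [expect_wt_map, partialRet_snoc]

theorem stagePerf_zero (U : Util H) (M : MDP S A H) (π : Policy S A H) :
    stagePerf U M π 0 H (Nat.zero_le H) le_rfl =
      stageValue (fun h s a => wt (M.p h s a)) M.r U H le_rfl M.s₀ 0 := by
  rw [stagePerf, histLaw, expect_wt_pure]
  simp [partialRet]

theorem stagePerf_last (U : Util H) (M : MDP S A H) (π : Policy S A H) :
    stagePerf U M π H 0 le_rfl (Nat.zero_le H) = perf U M π := rfl

theorem stagePerf_succ_le (U : Util H) (M : MDP S A H) (π : Policy S A H) (k j : ℕ)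
    (hkj : k + (j + 1) = H) (hk : k + 1 ≤ H) (hj : j + 1 ≤ H) :
    stagePerf U M π (k + 1) j hk (Nat.le_of_succ_le hj) ≤
      stagePerf U M π k (j + 1) (Nat.le_of_succ_le hk) hj := by
  rw [stagePerf_succ]
  refine expect_mono (wt_mem_stdSimplex _) fun ω => ?_
  have h : Fin.rev ⟨j, hj⟩ = (⟨k, hk⟩ : Fin H) := by
    ext
    simp only [Fin.val_rev]
    omega
  rw [stageValue, h]
  exact le_ciSup (f := fun a => expect (wt (M.p ⟨k, hk⟩ ω.2 a)) fun s' =>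
    stageValue (fun h s a => wt (M.p h s a)) M.r U j (Nat.le_of_succ_le hj) s'
      (partialRet M.r (Nat.le_of_succ_le hk) ω + M.r ⟨k, hk⟩ ω.2 a))
    (Set.finite_range _).bddAbove _

/-- Replacing the play of `π` by optimal play in the remaining stages does not hurt. -/
theorem perf_le_stagePerf (U : Util H) (M : MDP S A H) (π : Policy S A H) (j k : ℕ)
    (hkj : k + j = H) (hk : k ≤ H) (hj : j ≤ H) : perf U M π ≤ stagePerf U M π k j hk hj := by
  induction j generalizing k with
  | zero =>
    obtain rfl : k = H := hkj
    exact (stagePerf_last U M π).ge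
  | succ j ih =>
    exact (ih (k + 1) (by omega) (by omega) (Nat.le_of_succ_le hj)).trans
      (stagePerf_succ_le U M π k j hkj (by omega) hj)

/-- The optimal value is attained by a policy that plays, at every stage, an action that is optimal
for the enlarged state consisting of the current state and the accumulated reward. -/
theorem exists_perf_eq_stageValue [Nonempty A] (U : Util H) (M : MDP S A H) :
    ∃ π, perf U M π = stageValue (fun h s a => wt (M.p h s a)) M.r U H le_rfl M.s₀ 0 := by
  let Q : ∀ h : Fin H, S → ℝ → A → ℝ := fun h s y a =>
    expect (wt (M.p h s a)) fun s' =>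
      stageValue (fun h s a => wt (M.p h s a)) M.r U (Fin.rev h) (Fin.rev h).isLt.le s'
        (y + M.r h s a)
  have hQ : ∀ h s y, ∃ a, Q h s y a = ⨆ a, Q h s y a := fun h s y =>
    exists_eq_ciSup_of_finite
  choose act hact using hQ
  let π : Policy S A H := fun h ω => act h ω.2 (partialRet M.r h.isLt.le ω)
  have key : ∀ (j k : ℕ) (_ : k + j = H) (hk : k ≤ H) (hj : j ≤ H),
      perf U M π = stagePerf U M π k j hk hj := by
    intro j
    induction j with
    | zero =>
      intro k hkj hk hj
      obtain rfl : k = H := hkj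
      exact (stagePerf_last U M π).symm
    | succ j ih =>
      intro k hkj hk hj
      have hk' : k + 1 ≤ H := by omega
      rw [ih (k + 1) (by omega) hk' (Nat.le_of_succ_le hj), stagePerf_succ, stagePerf]
      congr 1
      funext ω
      have h1 := hact ⟨k, hk'⟩ ω.2 (partialRet M.r hk ω)
      have h2 : Fin.rev ⟨j, hj⟩ = (⟨k, hk'⟩ : Fin H) := by
        ext
        simp only [Fin.val_rev]
        omega
      have h3 : ((Fin.rev (⟨k, hk'⟩ : Fin H) : Fin H) : ℕ) = j := by
        simp only [Fin.val_rev]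
        omega
      rw [stageValue, h2]
      simp only [Q, h3] at h1
      exact h1
  exact ⟨π, (key H 0 (Nat.zero_add H) (Nat.zero_le H) le_rfl).trans (stagePerf_zero U M π)⟩

theorem optPerf_eq_stageValue [Nonempty A] (U : Util H) (M : MDP S A H) :
    optPerf U M = stageValue (fun h s a => wt (M.p h s a)) M.r U H le_rfl M.s₀ 0 := by
  have hle : ∀ π, perf U M π ≤ stageValue (fun h s a => wt (M.p h s a)) M.r U H le_rfl M.s₀ 0 :=
    fun π => (perf_le_stagePerf U M π H 0 (Nat.zero_add H) (Nat.zero_le H) le_rfl).trans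
      (stagePerf_zero U M π).le
  obtain ⟨π, hπ⟩ := exists_perf_eq_stageValue U M
  have : Nonempty (Policy S A H) := ⟨π⟩
  exact le_antisymm (ciSup_le hle) (hπ.ge.trans (le_ciSup ⟨_, Set.forall_mem_range.2 hle⟩ π))

end Optimality

/-! ### Discretization -/

section Discretization

theorem nearest_mem (X : Finset ℝ) (hX : X.Nonempty) (y : ℝ) : nearest X hX y ∈ X :=
  (X.exists_min_image (fun x => |y - x|) hX).choose_spec.1

theorem abs_sub_nearest_le (X : Finset ℝ) (hX : X.Nonempty) (y : ℝ) {x : ℝ} (hx : x ∈ X) :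
    |y - nearest X hX y| ≤ |y - x| :=
  (X.exists_min_image (fun x => |y - x|) hX).choose_spec.2 x hx

theorem abs_sub_floor_mul_le {ε₀ G : ℝ} (hε₀ : 0 < ε₀) (hG : 0 ≤ G) :
    |G - ⌊G / ε₀⌋₊ * ε₀| ≤ ε₀ := by
  have h1 := Nat.floor_le (div_nonneg hG hε₀.le)
  have h2 := Nat.lt_floor_add_one (G / ε₀)
  rw [le_div_iff₀ hε₀] at h1
  rw [div_lt_iff₀ hε₀] at h2
  rw [abs_le]
  constructor <;> linarith

variable {S : Type u} {A : Type v} {H : ℕ} {U : Util H} {L ε₀ : ℝ}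

theorem abs_sub_discReward_le (hε₀ : 0 < ε₀) {r : Fin H → S → A → ℝ}
    (hr : ∀ h s a, r h s a ∈ Set.Icc (0 : ℝ) 1) (h : Fin H) (s : S) (a : A) :
    |discReward ε₀ r h s a - r h s a| ≤ ε₀ := by
  have hr := hr h s a
  have hmem : (⌊r h s a / ε₀⌋₊ : ℝ) * ε₀ ∈ grid ε₀ 1 := by
    refine Finset.mem_image_of_mem (fun k : ℕ => (k : ℝ) * ε₀)
      (Finset.mem_range.2 (Nat.lt_succ_of_le (Nat.floor_le_floor ?_)))
    exact div_le_div_of_nonneg_right hr.2 hε₀.le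
  rw [abs_sub_comm]
  exact (abs_sub_nearest_le _ (grid_nonempty ε₀ 1) _ hmem).trans (abs_sub_floor_mul_le hε₀ hr.1)

theorem exists_discReward_eq (ε₀ : ℝ) (r : Fin H → S → A → ℝ) (h : Fin H) (s : S) (a : A) :
    ∃ m : ℕ, m ≤ ⌊1 / ε₀⌋₊ ∧ discReward ε₀ r h s a = m * ε₀ := by
  obtain ⟨m, hm, he⟩ := Finset.mem_image.1 (nearest_mem _ (grid_nonempty ε₀ 1) (r h s a))
  exact ⟨m, Nat.lt_succ_iff.1 (Finset.mem_range.1 hm), he.symm⟩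

theorem sum_grid (hε₀ : 0 < ε₀) (x : ℝ) (F : ℝ → ℝ) :
    ∑ y ∈ grid ε₀ x, F y = ∑ k ∈ Finset.range (⌊x / ε₀⌋₊ + 1), F (k * ε₀) := by
  refine Finset.sum_image fun a _ b _ hab => ?_
  exact_mod_cast mul_right_cancel₀ hε₀.ne' hab

/-- Between the ends of the grid, the categorical projection is linear interpolation. -/
theorem sum_catProj_of_pos (hε₀ : 0 < ε₀) {x G : ℝ} (hG : 0 < G)
    (hGx : G ≤ ⌊x / ε₀⌋₊ * ε₀) (F : ℝ → ℝ) :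
    ∃ k : ℕ, k * ε₀ < G ∧ G ≤ (k + 1) * ε₀ ∧ ∑ y ∈ grid ε₀ x, catProj ε₀ x G y * F y =
      ((k + 1) * ε₀ - G) / ε₀ * F (k * ε₀) + (G - k * ε₀) / ε₀ * F ((k + 1) * ε₀) := by
  have hpos : 0 < ⌈G / ε₀⌉₊ := Nat.ceil_pos.2 (div_pos hG hε₀)
  obtain ⟨k, hk⟩ : ∃ k, ⌈G / ε₀⌉₊ = k + 1 := ⟨⌈G / ε₀⌉₊ - 1, by omega⟩
  have hkx : k + 1 ≤ ⌊x / ε₀⌋₊ := by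
    rw [← hk, Nat.ceil_le, div_le_iff₀ hε₀]
    exact hGx
  have h1 : (k : ℝ) * ε₀ < G := by
    rw [← lt_div_iff₀ hε₀, ← Nat.lt_ceil, hk]
    exact Nat.lt_succ_self k
  have h2 : G ≤ (k + 1) * ε₀ := by
    rw [← div_le_iff₀ hε₀]
    have := Nat.le_ceil (G / ε₀)
    rw [hk] at this
    exact_mod_cast this
  refine ⟨k, h1, h2, ?_⟩
  rw [sum_grid hε₀]
  have hterm : ∀ m : ℕ, catProj ε₀ x G (m * ε₀) * F (m * ε₀) =
      (if m = k then ((k + 1) * ε₀ - G) / ε₀ * F (k * ε₀) else 0) +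
        if m = k + 1 then (G - k * ε₀) / ε₀ * F ((k + 1) * ε₀) else 0 := by
    intro m
    have hiff1 : ((m : ℝ) * ε₀ < G ∧ G ≤ m * ε₀ + ε₀) ↔ m = k := by
      constructor
      · rintro ⟨h3, h4⟩
        have h5 : (m : ℝ) < k + 1 := lt_of_mul_lt_mul_right (h3.trans_le h2) hε₀.le
        have h6 : (k : ℝ) < m + 1 :=
          lt_of_mul_lt_mul_right (h1.trans_le (by linarith)) hε₀.le
        have h7 : m < k + 1 := by exact_mod_cast h5
        have h8 : k < m + 1 := by exact_mod_cast h6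
        omega
      · rintro rfl
        exact ⟨h1, by linarith⟩
    have hiff2 : ((m : ℝ) * ε₀ - ε₀ < G ∧ G ≤ m * ε₀) ↔ m = k + 1 := by
      constructor
      · rintro ⟨h3, h4⟩
        have h5 : (m : ℝ) < k + 2 := lt_of_mul_lt_mul_right (a := ε₀) (by linarith) hε₀.le
        have h6 : (k : ℝ) < m := lt_of_mul_lt_mul_right (h1.trans_le h4) hε₀.le
        have h7 : m < k + 2 := by exact_mod_cast h5
        have h8 : k < m := by exact_mod_cast h6
        omega
      · rintro rfl
        push_cast
        exact ⟨by linarith, h2⟩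
    rw [catProj, if_neg hG.not_ge, if_neg hGx.not_gt]
    simp only [hiff1, hiff2]
    by_cases h3 : m = k
    · subst h3
      simp [add_mul]
    · by_cases h4 : m = k + 1
      · subst h4
        simp [add_mul]
      · simp [h3, h4]
  rw [Finset.sum_congr rfl fun m _ => hterm m, Finset.sum_add_distrib, Finset.sum_ite_eq',
    Finset.sum_ite_eq', if_pos (Finset.mem_range.2 (by omega)),
    if_pos (Finset.mem_range.2 (by omega))]

/-- The categorical projection moves mass by at most `ε₀`, so it changes the expectation of an
`L`-Lipschitz function by at most `L ε₀`. -/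
theorem abs_sum_catProj_sub_le (hε₀ : 0 < ε₀) (hL : 0 ≤ L) (hU : U ∈ lipUtilities H L) {G : ℝ}
    (hG : G ∈ Set.Icc (0 : ℝ) H) :
    |∑ y ∈ grid ε₀ H, catProj ε₀ H G y * U.eval y - U.eval G| ≤ L * ε₀ := by
  rcases hG.1.eq_or_lt with rfl | hpos
  · rw [sum_grid hε₀, Finset.sum_eq_single 0]
    · simpa [catProj] using mul_nonneg hL hε₀.le
    · intro m _ hm
      simp [catProj, hm, hε₀.ne']
    · simp
  by_cases hGx : (⌊(H : ℝ) / ε₀⌋₊ : ℝ) * ε₀ < G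
  · rw [sum_grid hε₀, Finset.sum_eq_single ⌊(H : ℝ) / ε₀⌋₊]
    · rw [catProj, if_neg hpos.not_ge, if_pos hGx, if_pos rfl, one_mul]
      refine (Util.abs_eval_sub_le hL hU _ _).trans (mul_le_mul_of_nonneg_left ?_ hL)
      have := (abs_le.1 (abs_sub_floor_mul_le hε₀ (Nat.cast_nonneg (α := ℝ) H))).2
      rw [abs_le]
      constructor <;> linarith [hG.2]
    · intro m _ hm
      have : (m : ℝ) * ε₀ ≠ ⌊(H : ℝ) / ε₀⌋₊ * ε₀ := fun h =>
        hm (by exact_mod_cast mul_right_cancel₀ hε₀.ne' h)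
      rw [catProj, if_neg hpos.not_ge, if_pos hGx, if_neg this, zero_mul]
    · simp
  · obtain ⟨k, h1, h2, h3⟩ := sum_catProj_of_pos hε₀ hpos (not_lt.1 hGx) U.eval
    rw [h3]
    have hw : ((k + 1) * ε₀ - G) / ε₀ = 1 - (G - k * ε₀) / ε₀ := by
      field_simp
      ring
    rw [hw]
    set w := (G - k * ε₀) / ε₀ with hwdef
    have hw0 : 0 ≤ w := div_nonneg (by linarith) hε₀.le
    have hw1 : w ≤ 1 := (div_le_one hε₀).2 (by linarith)
    have h4 : |U.eval (k * ε₀) - U.eval G| ≤ L * ε₀ :=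
      (Util.abs_eval_sub_le hL hU _ _).trans
        (mul_le_mul_of_nonneg_left (abs_le.2 ⟨by linarith, by linarith⟩) hL)
    have h5 : |U.eval ((k + 1) * ε₀) - U.eval G| ≤ L * ε₀ :=
      (Util.abs_eval_sub_le hL hU _ _).trans
        (mul_le_mul_of_nonneg_left (abs_le.2 ⟨by linarith, by linarith⟩) hL)
    rw [abs_le] at h4 h5 ⊢
    constructor <;> nlinarith

/-- A utility is within `L ε₀` of a step function with jumps at the positive grid points. -/
theorem abs_eval_sub_sum_steps_le (hε₀ : 0 < ε₀) (hL : 0 ≤ L) (hU : U ∈ lipUtilities H L) {G : ℝ}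
    (hG : G ∈ Set.Icc (0 : ℝ) H) :
    |U.eval G - ∑ k ∈ Finset.range ⌊(H : ℝ) / ε₀⌋₊,
      (U.eval ((k + 1 : ℕ) * ε₀) - U.eval (k * ε₀)) *
        (if ((k + 1 : ℕ) : ℝ) * ε₀ ≤ G then 1 else 0)| ≤ L * ε₀ := by
  have hsub : Finset.range ⌊G / ε₀⌋₊ ⊆ Finset.range ⌊(H : ℝ) / ε₀⌋₊ :=
    Finset.range_subset_range.2 (Nat.floor_le_floor (div_le_div_of_nonneg_right hG.2 hε₀.le))
  have hiff : ∀ k : ℕ, ((k + 1 : ℕ) : ℝ) * ε₀ ≤ G ↔ k < ⌊G / ε₀⌋₊ := by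
    intro k
    rw [← le_div_iff₀ hε₀, ← Nat.le_floor_iff (div_nonneg hG.1 hε₀.le), Nat.succ_le_iff]
  have hsum : ∑ k ∈ Finset.range ⌊(H : ℝ) / ε₀⌋₊,
      (U.eval ((k + 1 : ℕ) * ε₀) - U.eval (k * ε₀)) *
        (if ((k + 1 : ℕ) : ℝ) * ε₀ ≤ G then 1 else 0) = U.eval (⌊G / ε₀⌋₊ * ε₀) := by
    rw [← Finset.sum_subset hsub]
    · rw [Finset.sum_congr rfl fun k hk => by
        rw [if_pos ((hiff k).2 (Finset.mem_range.1 hk)), mul_one]]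
      rw [Finset.sum_range_sub fun k : ℕ => U.eval (k * ε₀)]
      simp [hU.1.1]
    · intro k _ hk
      rw [if_neg (fun h => hk (Finset.mem_range.2 ((hiff k).1 h))), mul_zero]
  rw [hsum]
  exact (Util.abs_eval_sub_le hL hU _ _).trans
    (mul_le_mul_of_nonneg_left (abs_sub_floor_mul_le hε₀ hG.1) hL)

/-- If two distributions give nearby masses to the events that `G` reaches a grid point, then they
give nearby expectations to all utilities of `G`. -/
theorem abs_expect_eval_sub_le {Ω : Type*} [Fintype Ω] {p q : Ω → ℝ} (hp : p ∈ stdSimplex ℝ Ω)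
    (hq : q ∈ stdSimplex ℝ Ω) {G : Ω → ℝ} (hG : ∀ x, G x ∈ Set.Icc (0 : ℝ) H) (hε₀ : 0 < ε₀)
    (hL : 0 ≤ L) (hU : U ∈ lipUtilities H L) {β : ℝ} (hβ : 0 ≤ β)
    (h : ∀ k < ⌊(H : ℝ) / ε₀⌋₊,
      |expect q (fun x => if ((k + 1 : ℕ) : ℝ) * ε₀ ≤ G x then 1 else 0) -
        expect p (fun x => if ((k + 1 : ℕ) : ℝ) * ε₀ ≤ G x then 1 else 0)| ≤ β) :
    |expect q (fun x => U.eval (G x)) - expect p (fun x => U.eval (G x))| ≤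
      2 * (L * ε₀) + H * β := by
  let c : ℕ → ℝ := fun k => U.eval ((k + 1 : ℕ) * ε₀) - U.eval (k * ε₀)
  let e : ℕ → Ω → ℝ := fun k x => if ((k + 1 : ℕ) : ℝ) * ε₀ ≤ G x then 1 else 0
  have hc : ∀ k, 0 ≤ c k := fun k => sub_nonneg.2 (Util.eval_mono hU.1.2.2.1
    (mul_le_mul_of_nonneg_right (by exact_mod_cast Nat.le_succ k) hε₀.le))
  have hcsum : ∑ k ∈ Finset.range ⌊(H : ℝ) / ε₀⌋₊, c k ≤ H := by
    rw [Finset.sum_range_sub fun k : ℕ => U.eval (k * ε₀)]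
    have h0 : U.eval ((0 : ℕ) * ε₀) = 0 := by simp [hU.1.1]
    rw [h0, sub_zero]
    exact (U.eval_mem_Icc _).2
  have hstep : ∀ w ∈ stdSimplex ℝ Ω, |expect w (fun x => U.eval (G x)) -
      ∑ k ∈ Finset.range ⌊(H : ℝ) / ε₀⌋₊, c k * expect w (e k)| ≤ L * ε₀ := by
    intro w hw
    have h1 := abs_expect_sub_le hw fun x => abs_eval_sub_sum_steps_le hε₀ hL hU (hG x)
    rw [expect_sum] at h1
    simp only [expect_const_mul] at h1
    exact h1
  have hdiff : |∑ k ∈ Finset.range ⌊(H : ℝ) / ε₀⌋₊, c k * expect q (e k) -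
      ∑ k ∈ Finset.range ⌊(H : ℝ) / ε₀⌋₊, c k * expect p (e k)| ≤ H * β := by
    rw [← Finset.sum_sub_distrib]
    calc |∑ k ∈ Finset.range ⌊(H : ℝ) / ε₀⌋₊, (c k * expect q (e k) - c k * expect p (e k))|
        ≤ ∑ k ∈ Finset.range ⌊(H : ℝ) / ε₀⌋₊, c k * β := by
          refine (Finset.abs_sum_le_sum_abs _ _).trans (Finset.sum_le_sum fun k hk => ?_)
          rw [← mul_sub, abs_mul, abs_of_nonneg (hc k)]
          exact mul_le_mul_of_nonneg_left (h k (Finset.mem_range.1 hk)) (hc k)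
      _ = (∑ k ∈ Finset.range ⌊(H : ℝ) / ε₀⌋₊, c k) * β := (Finset.sum_mul _ _ _).symm
      _ ≤ H * β := mul_le_mul_of_nonneg_right hcsum hβ
  have h1 := hstep q hq
  have h2 := hstep p hp
  rw [abs_le] at h1 h2 hdiff ⊢
  constructor <;> linarith

end Discretization

/-! ### The estimates computed from the samples -/

section Estimates

open Classical in
/-- The empirical distribution of a sample. -/
noncomputable def empWt {Ω : Type*} {n : ℕ} (x : Fin n → Ω) (s : Ω) : ℝ :=
  (∑ j, if x j = s then (1 : ℝ) else 0) / n

theorem expect_empWt {Ω : Type*} [Fintype Ω] {n : ℕ} (x : Fin n → Ω) (f : Ω → ℝ) :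
    expect (empWt x) f = empMean x f := by
  classical
  simp only [expect, empWt, empMean, div_mul_eq_mul_div, ← Finset.sum_div, Finset.sum_mul]
  rw [Finset.sum_comm]
  simp

theorem empWt_mem_stdSimplex {Ω : Type*} [Fintype Ω] {n : ℕ} (hn : 0 < n) (x : Fin n → Ω) :
    empWt x ∈ stdSimplex ℝ Ω := by
  classical
  refine ⟨fun s => div_nonneg (Finset.sum_nonneg fun j _ => by split_ifs <;> norm_num)
    (Nat.cast_nonneg n), ?_⟩
  have h := expect_empWt x fun _ => 1
  have hn' : (n : ℝ) ≠ 0 := by exact_mod_cast hn.ne'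
  simpa [expect, empMean, hn'] using h

variable {S : Type u} {A : Type v} {H : ℕ} {U : Util H} {L ε₀ : ℝ}

theorem ret_mem_Icc (M : MDP S A H) (ω : Hist S A H) : ret M.r ω ∈ Set.Icc (0 : ℝ) H := by
  refine ⟨Finset.sum_nonneg fun h _ => (M.r_mem h _ _).1, ?_⟩
  refine (Finset.sum_le_sum fun h _ => (M.r_mem h _ _).2).trans ?_
  simp

variable [Fintype S] [Fintype A]

theorem abs_sum_erd_sub_le (hε₀ : 0 < ε₀) (hL : 0 ≤ L) (hU : U ∈ lipUtilities H L) (M : MDP S A H)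
    {τ : ℕ} (hτ : 0 < τ) (D : Fin τ → Hist S A H) :
    |∑ y ∈ grid ε₀ H, erd ε₀ M.r D y * U.eval y - expect (empWt D) fun ω => U.eval (ret M.r ω)| ≤
      L * ε₀ := by
  have h1 : ∑ y ∈ grid ε₀ H, erd ε₀ M.r D y * U.eval y =
      expect (empWt D) fun ω => ∑ y ∈ grid ε₀ H, catProj ε₀ H (ret M.r ω) y * U.eval y := by
    rw [expect_empWt, empMean, Finset.sum_comm, Finset.sum_div]
    refine Finset.sum_congr rfl fun y _ => ?_
    rw [erd, div_mul_eq_mul_div, Finset.sum_mul]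
  rw [h1]
  exact abs_expect_sub_le (empWt_mem_stdSimplex hτ D) fun ω =>
    abs_sum_catProj_sub_le hε₀ hL hU (ret_mem_Icc M ω)

variable [Nonempty A]

/-- Discretizing the rewards costs at most `L H ε₀`. -/
theorem abs_stageValue_discReward_sub_optPerf_le (hε₀ : 0 < ε₀) (hL : 0 ≤ L)
    (hU : U ∈ lipUtilities H L) (M : MDP S A H) :
    |stageValue (fun h s a => wt (M.p h s a)) (discReward ε₀ M.r) U H le_rfl M.s₀ 0 -
      optPerf U M| ≤ L * (H * ε₀) := by
  rw [optPerf_eq_stageValue]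
  have := abs_stageValue_sub_le_of_reward (fun h s a => wt_mem_stdSimplex (M.p h s a)) hL hU
    (fun h s a => abs_sub_discReward_le hε₀ M.r_mem h s a) H le_rfl M.s₀ 0 0
  simpa using this

variable [NeZero H]

/-- The planning error when the empirical model is close to the true model on the optimal value
functions for the one utility `U`. -/
theorem abs_planning_sub_optPerf_le_of_varClose (hε₀ : 0 < ε₀) (hL : 0 ≤ L)
    (hU : U ∈ lipUtilities H L) (M : MDP S A H) {n : ℕ} (hn : 0 < n)
    (X : Fin H × S × A → Fin n → S) {θ t t' : ℝ} (hθ : 0 ≤ θ) (hθH : 4 * θ * H ≤ 1)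
    (h : ∀ (j : Fin H) (s : S) (a : A), ∀ m ∈ Finset.range (H * ⌊1 / ε₀⌋₊ + 1),
      VarClose (wt (M.p (Fin.rev j) s a)) (empWt (X (Fin.rev j, s, a))) θ t t' fun s' =>
        stageValue (fun h s a => wt (M.p h s a)) (discReward ε₀ M.r) U j j.isLt.le s' (m * ε₀)) :
    |planning M.s₀ (explore X) (discReward ε₀ M.r) U - optPerf U M| ≤
      2 * θ * H ^ 2 + H * (t + 2 * θ * t') + L * (H * ε₀) := by
  have hq : ∀ h s a, explore X h s a ∈ stdSimplex ℝ S := fun h s a => empWt_mem_stdSimplex hn _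
  rw [planning_eq_stageValue hq]
  have h1 := abs_stageValue_discReward_sub_optPerf_le hε₀ hL hU M
  have h2 := abs_stageValue_sub_add_le (r := discReward ε₀ M.r) (U := U)
    (fun h s a => wt_mem_stdSimplex (M.p h s a)) hq hθ hθH
    (fun j => {y | ∃ m : ℕ, m ≤ (H - j) * ⌊1 / ε₀⌋₊ ∧ y = m * ε₀}) (t := t) (t' := t')
    (by
      rintro j hj s a y ⟨m, hm, rfl⟩
      obtain ⟨m', hm', he⟩ := exists_discReward_eq ε₀ M.r (Fin.rev ⟨j, hj⟩) s a
      refine ⟨m + m', ?_, by rw [he]; push_cast; ring⟩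
      have h3 : H - j = H - (j + 1) + 1 := by omega
      rw [h3, add_mul, one_mul]
      exact Nat.add_le_add hm hm')
    (by
      rintro j hj s a y ⟨m, hm, rfl⟩
      exact h ⟨j, hj⟩ s a m (Finset.mem_range.2 (Nat.lt_succ_of_le
        (hm.trans (Nat.mul_le_mul_right _ (Nat.sub_le H j))))))
    H le_rfl M.s₀ 0 ⟨0, Nat.zero_le _, by simp⟩
  have h3 := mul_nonneg (mul_nonneg zero_le_two hθ) (sq_nonneg
    (stageValue (fun h s a => wt (M.p h s a)) (discReward ε₀ M.r) U H le_rfl M.s₀ 0))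
  have h4 := abs_sub_le (stageValue (explore X) (discReward ε₀ M.r) U H le_rfl M.s₀ 0)
    (stageValue (fun h s a => wt (M.p h s a)) (discReward ε₀ M.r) U H le_rfl M.s₀ 0) (optPerf U M)
  linarith

/-- The planning error when the empirical model is close to the true model on all events. -/
theorem abs_planning_sub_optPerf_le_of_sum_le (hε₀ : 0 < ε₀) (hL : 0 ≤ L)
    (hU : U ∈ lipUtilities H L) (M : MDP S A H) {n : ℕ} (hn : 0 < n)
    (X : Fin H × S × A → Fin n → S) {β : ℝ}
    (h : ∀ h s a, ∀ T : Finset S,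
      ∑ s' ∈ T, empWt (X (h, s, a)) s' ≤ ∑ s' ∈ T, wt (M.p h s a) s' + β) :
    |planning M.s₀ (explore X) (discReward ε₀ M.r) U - optPerf U M| ≤
      H * (H * β) + L * (H * ε₀) := by
  have hq : ∀ h s a, explore X h s a ∈ stdSimplex ℝ S := fun h s a => empWt_mem_stdSimplex hn _
  rw [planning_eq_stageValue hq]
  have h1 := abs_stageValue_discReward_sub_optPerf_le hε₀ hL hU M
  have h2 := abs_stageValue_sub_le_of_transition (r := discReward ε₀ M.r) (U := U)
    (fun h s a => wt_mem_stdSimplex (M.p h s a)) hq (β := H * β)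
    (fun hh s a f hf => abs_expect_sub_le_of_sum_le (wt_mem_stdSimplex _) (hq hh s a)
      (Nat.cast_nonneg H) (h hh s a) hf) H le_rfl M.s₀ 0
  exact (abs_sub_le _ _ _).trans (add_le_add h2 h1)

end Estimates

/-! ### Failure probabilities -/

section Failure

variable {Ω : Type*} [Fintype Ω]

theorem abs_mul_sub_expect_le_one {q f : Ω → ℝ} (hq : q ∈ stdSimplex ℝ Ω) {B θ : ℝ}
    (hf : ∀ x, f x ∈ Set.Icc 0 B) (hθ : 0 ≤ θ) (hθB : θ * B ≤ 1) (x : Ω) :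
    |θ * (f x - expect q f)| ≤ 1 := by
  have h1 := expect_mem_Icc hq hf
  rw [abs_mul, abs_of_nonneg hθ]
  refine (mul_le_mul_of_nonneg_left (abs_le.2 ⟨?_, ?_⟩) hθ).trans hθB
  · linarith [h1.2, (hf x).1]
  · linarith [h1.1, (hf x).2]

variable [MeasurableSpace Ω] [DiscreteMeasurableSpace Ω]

theorem measure_expect_add_lt_expect_empWt_le (p : PMF Ω) {f : Ω → ℝ} {B θ t : ℝ}
    (hf : ∀ x, f x ∈ Set.Icc 0 B) (hθ : 0 < θ) (hθB : θ * B ≤ 1) (n : ℕ) :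
    (Measure.pi fun _ : Fin n => p.toMeasure)
        {x | expect (wt p) f + θ * var (wt p) f + t < expect (empWt x) f} ≤
      ENNReal.ofReal (Real.exp (-(n * (θ * t)))) := by
  simp only [expect_empWt]
  exact measure_expect_add_lt_empMean_le p f hθ
    (abs_mul_sub_expect_le_one (wt_mem_stdSimplex p) hf hθ.le hθB) n

theorem measure_expect_empWt_add_lt_le (p : PMF Ω) {f : Ω → ℝ} {B θ t : ℝ}
    (hf : ∀ x, f x ∈ Set.Icc 0 B) (hθ : 0 < θ) (hθB : θ * B ≤ 1) (n : ℕ) :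
    (Measure.pi fun _ : Fin n => p.toMeasure)
        {x | expect (empWt x) f + θ * var (wt p) f + t < expect (wt p) f} ≤
      ENNReal.ofReal (Real.exp (-(n * (θ * t)))) := by
  have h := measure_expect_add_lt_empMean_le p (fun x => -f x) (t := t) hθ (fun x => by
    have := abs_mul_sub_expect_le_one (wt_mem_stdSimplex p) hf hθ.le hθB x
    rw [expect_neg, ← abs_neg]
    convert this using 2
    ring) n
  refine (measure_mono fun x hx => ?_).trans h
  simp only [Set.mem_ofPred_eq, ← expect_empWt, expect_neg, var_neg] at hx ⊢
  linarith

/-- `VarClose` fails only if the linearized Bernstein inequality fails for `f`, `-f` or `-f ^ 2`. -/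
theorem measure_not_varClose_le (p : PMF Ω) {f : Ω → ℝ} {B θ t t' : ℝ} (hB : 0 < B)
    (hf : ∀ x, f x ∈ Set.Icc 0 B) (hθ : 0 < θ) (hθB : θ * B ≤ 1) (n : ℕ) :
    (Measure.pi fun _ : Fin n => p.toMeasure) {x | ¬ VarClose (wt p) (empWt x) θ t t' f} ≤
      ENNReal.ofReal (2 * Real.exp (-(n * (θ * t))) +
        Real.exp (-(n * (1 / (8 * B ^ 2) * t')))) := by
  have hB2 : 0 < B ^ 2 := pow_pos hB 2
  have h1 := measure_expect_add_lt_expect_empWt_le p (t := t) hf hθ hθB n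
  have h2 := measure_expect_empWt_add_lt_le p (t := t) hf hθ hθB n
  -- the exponent is chosen such that it turns the bound on the variance of `f ^ 2` into half of
  -- the variance of `f`
  have h3 := measure_expect_empWt_add_lt_le p (f := fun x => f x ^ 2) (B := B ^ 2)
    (θ := 1 / (8 * B ^ 2)) (t := t')
    (fun x => ⟨sq_nonneg _, pow_le_pow_left₀ (hf x).1 (hf x).2 2⟩) (by positivity)
    (by rw [div_mul_eq_mul_div, div_le_one (by positivity)]; linarith) n
  have hsub : {x : Fin n → Ω | ¬ VarClose (wt p) (empWt x) θ t t' f} ⊆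
      ({x | expect (wt p) f + θ * var (wt p) f + t < expect (empWt x) f} ∪
        {x | expect (empWt x) f + θ * var (wt p) f + t < expect (wt p) f}) ∪
        {x | expect (empWt x) (fun x => f x ^ 2) +
          1 / (8 * B ^ 2) * var (wt p) (fun x => f x ^ 2) + t' <
            expect (wt p) (fun x => f x ^ 2)} := by
    intro x hx
    by_contra hcon
    simp only [Set.mem_union, Set.mem_ofPred_eq, not_or, not_lt] at hcon
    refine hx ⟨hcon.1.1, hcon.1.2, hcon.2.trans ?_⟩
    have hv := var_sq_le (wt_mem_stdSimplex p) hf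
    have : 1 / (8 * B ^ 2) * var (wt p) (fun x => f x ^ 2) ≤ var (wt p) f / 2 := by
      rw [div_mul_eq_mul_div, one_mul, div_le_iff₀ (by positivity)]
      linarith
    linarith
  refine (measure_mono hsub).trans ((measure_union_le _ _).trans
    ((add_le_add (measure_union_le _ _) le_rfl).trans
      ((add_le_add (add_le_add h1 h2) h3).trans (le_of_eq ?_))))
  rw [← ENNReal.ofReal_add (by positivity) (by positivity),
    ← ENNReal.ofReal_add (by positivity) (by positivity), two_mul]

theorem measure_lt_abs_sub_le (p : PMF Ω) {f : Ω → ℝ} {B θ t β : ℝ}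
    (hf : ∀ x, f x ∈ Set.Icc 0 B) (hθ : 0 < θ) (hθB : θ * B ≤ 1) (hβ : θ * B ^ 2 + t ≤ β) (n : ℕ) :
    (Measure.pi fun _ : Fin n => p.toMeasure)
        {x | β < |expect (empWt x) f - expect (wt p) f|} ≤
      ENNReal.ofReal (2 * Real.exp (-(n * (θ * t)))) := by
  have h1 := measure_expect_add_lt_expect_empWt_le p (t := t) hf hθ hθB n
  have h2 := measure_expect_empWt_add_lt_le p (t := t) hf hθ hθB n
  have hv := mul_le_mul_of_nonneg_left (var_le_of_mem_Icc (wt_mem_stdSimplex p) hf) hθ.le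
  refine (measure_mono fun x hx => ?_).trans ((measure_union_le _ _).trans
    ((add_le_add h1 h2).trans (le_of_eq ?_)))
  · rw [Set.mem_ofPred_eq, lt_abs] at hx
    rcases hx with hx | hx
    · refine Or.inl ?_
      rw [Set.mem_ofPred_eq]
      linarith
    · refine Or.inr ?_
      rw [Set.mem_ofPred_eq]
      linarith
  · rw [← ENNReal.ofReal_add (by positivity) (by positivity), two_mul]

theorem measure_sum_add_lt_sum_le (p : PMF Ω) (T : Finset Ω) {θ t β : ℝ} (hθ : 0 < θ) (hθ1 : θ ≤ 1)
    (hβ : θ + t ≤ β) (n : ℕ) :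
    (Measure.pi fun _ : Fin n => p.toMeasure)
        {x | ∑ s ∈ T, wt p s + β < ∑ s ∈ T, empWt x s} ≤
      ENNReal.ofReal (Real.exp (-(n * (θ * t)))) := by
  classical
  have hf : ∀ s, (if s ∈ T then (1 : ℝ) else 0) ∈ Set.Icc (0 : ℝ) 1 := fun s => by
    split_ifs <;> simp
  have h1 := measure_expect_add_lt_expect_empWt_le p (t := t) hf hθ (by linarith) n
  have hv := mul_le_mul_of_nonneg_left (var_le_of_mem_Icc (wt_mem_stdSimplex p) hf) hθ.le
  have hsum : ∀ q : Ω → ℝ, expect q (fun s => if s ∈ T then (1 : ℝ) else 0) = ∑ s ∈ T, q s :=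
    fun q => by simp [expect]
  refine (measure_mono fun x hx => ?_).trans h1
  rw [Set.mem_ofPred_eq] at hx
  rw [Set.mem_ofPred_eq, hsum, hsum]
  linarith

theorem measure_exists_le {α ι : Type*} [MeasurableSpace α] [Fintype ι] (μ : Measure α)
    (P : ι → α → Prop) {c : ℝ} (h : ∀ i, μ {x | P i x} ≤ ENNReal.ofReal c) :
    μ {x | ∃ i, P i x} ≤ ENNReal.ofReal (Fintype.card ι * c) := by
  have h1 : {x | ∃ i, P i x} = ⋃ i, {x | P i x} := by
    ext x
    simp
  rw [h1]
  refine (measure_iUnion_fintype_le μ _).trans ((Finset.sum_le_sum fun i _ => h i).trans ?_)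
  rw [Finset.sum_const, Finset.card_univ, nsmul_eq_mul, ENNReal.ofReal_mul (Nat.cast_nonneg _),
    ENNReal.ofReal_natCast]

/-- A union bound over the coordinates of a product measure. -/
theorem measure_pi_exists_le {κ ι : Type*} [Fintype κ] [Fintype ι] {α : κ → Type*}
    [∀ k, MeasurableSpace (α k)] [∀ k, DiscreteMeasurableSpace (α k)] (μ : ∀ k, Measure (α k))
    [∀ k, IsProbabilityMeasure (μ k)] (P : ∀ k, ι → α k → Prop) {c : ℝ}
    (h : ∀ k i, μ k {x | P k i x} ≤ ENNReal.ofReal c) :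
    Measure.pi μ {x | ∃ ki : κ × ι, P ki.1 ki.2 (x ki.1)} ≤
      ENNReal.ofReal (Fintype.card κ * Fintype.card ι * c) := by
  rw [← Nat.cast_mul, ← Fintype.card_prod]
  refine measure_exists_le _ (fun (ki : κ × ι) (x : ∀ k, α k) => P ki.1 ki.2 (x ki.1)) fun ki => ?_
  refine le_trans (le_of_eq ?_) (h ki.1 ki.2)
  exact (measurePreserving_eval μ ki.1).measure_preimage
    (MeasurableSet.of_discrete (s := {x | P ki.1 ki.2 x})).nullMeasurableSet

end Failure

section DataLaw

variable {N H : ℕ} [NeZero N] {S : Fin N → Type u} {A : Fin N → Type v} [∀ i, Fintype (S i)]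
  [∀ i, Fintype (A i)] [∀ i, MeasurableSpace (S i)] [∀ i, DiscreteMeasurableSpace (S i)]
  [∀ i, MeasurableSpace (A i)] [∀ i, DiscreteMeasurableSpace (A i)]

/-- The union bound over the environments and the two kinds of data. -/
theorem ofReal_one_sub_le_dataLaw (M : ∀ i, MDP (S i) (A i) H) (πE : ∀ i, Policy (S i) (A i) H)
    (τE n : Fin N → ℕ) {δ : ℝ} (hδ : 0 ≤ δ) (G : Set (Data H S A τE n))
    (E : ∀ i, Set (Fin (τE i) → Hist (S i) (A i) H))
    (P : ∀ i, Set (Fin H × S i × A i → Fin (n i) → S i))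
    (hE : ∀ i, (Measure.pi fun _ : Fin (τE i) => (trajLaw (M i) (πE i)).toMeasure) (E i) ≤
      ENNReal.ofReal (δ / (2 * N)))
    (hP : ∀ i, (Measure.pi fun x : Fin H × S i × A i =>
      Measure.pi fun _ : Fin (n i) => ((M i).p x.1 x.2.1 x.2.2).toMeasure) (P i) ≤
        ENNReal.ofReal (δ / (2 * N)))
    (hG : ∀ ω : Data H S A τE n, (∀ i, ω.1 i ∉ E i) → (∀ i, ω.2 i ∉ P i) → ω ∈ G) :
    ENNReal.ofReal (1 - δ) ≤ dataLaw M πE τE n G := by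
  have hN : (0 : ℝ) < N := by exact_mod_cast NeZero.pos N
  -- the data spaces are finite with measurable singletons, so every event is measurable
  have dE : ∀ i, DiscreteMeasurableSpace (Fin (τE i) → Hist (S i) (A i) H) := fun i =>
    inferInstance
  have dP : ∀ i, DiscreteMeasurableSpace (Fin H × S i × A i → Fin (n i) → S i) := fun i =>
    inferInstance
  have sE : ∀ i, MeasurableSingletonClass (Fin (τE i) → Hist (S i) (A i) H) := fun i =>
    inferInstance
  have cE : ∀ i, Finite (Fin (τE i) → Hist (S i) (A i) H) := fun i => inferInstance
  have dE' : DiscreteMeasurableSpace (∀ i, Fin (τE i) → Hist (S i) (A i) H) := inferInstance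
  have dP' : DiscreteMeasurableSpace (∀ i, Fin H × S i × A i → Fin (n i) → S i) := inferInstance
  unfold dataLaw
  set μE : ∀ i, Measure (Fin (τE i) → Hist (S i) (A i) H) := fun i =>
    Measure.pi fun _ : Fin (τE i) => (trajLaw (M i) (πE i)).toMeasure with hμE
  set μP : ∀ i, Measure (Fin H × S i × A i → Fin (n i) → S i) := fun i =>
    Measure.pi fun x : Fin H × S i × A i =>
      Measure.pi fun _ : Fin (n i) => ((M i).p x.1 x.2.1 x.2.2).toMeasure with hμP
  have h1 : Measure.pi μE {x | ∃ ki : Fin N × Unit, x ki.1 ∈ E ki.1} ≤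
      ENNReal.ofReal (Fintype.card (Fin N) * Fintype.card Unit * (δ / (2 * N))) :=
    measure_pi_exists_le μE (fun k (_ : Unit) x => x ∈ E k) fun k _ => hE k
  have h2 : Measure.pi μP {x | ∃ ki : Fin N × Unit, x ki.1 ∈ P ki.1} ≤
      ENNReal.ofReal (Fintype.card (Fin N) * Fintype.card Unit * (δ / (2 * N))) :=
    measure_pi_exists_le μP (fun k (_ : Unit) x => x ∈ P k) fun k _ => hP k
  have h3 : (Fintype.card (Fin N) * Fintype.card Unit * (δ / (2 * N)) : ℝ) = δ / 2 := by
    simp only [Fintype.card_fin, Fintype.card_unit, Nat.cast_one]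
    field_simp
  rw [h3] at h1 h2
  set μ := (Measure.pi μE).prod (Measure.pi μP) with hμ
  have h4 : μ (Prod.fst ⁻¹' {x | ∃ ki : Fin N × Unit, x ki.1 ∈ E ki.1}) ≤
      ENNReal.ofReal (δ / 2) := by
    rw [measurePreserving_fst.measure_preimage MeasurableSet.of_discrete.nullMeasurableSet]
    exact h1
  have h5 : μ (Prod.snd ⁻¹' {x | ∃ ki : Fin N × Unit, x ki.1 ∈ P ki.1}) ≤
      ENNReal.ofReal (δ / 2) := by
    rw [measurePreserving_snd.measure_preimage MeasurableSet.of_discrete.nullMeasurableSet]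
    exact h2
  have hcover : (Set.univ : Set (Data H S A τE n)) ⊆ G ∪
      (Prod.fst ⁻¹' {x | ∃ ki : Fin N × Unit, x ki.1 ∈ E ki.1} ∪
        Prod.snd ⁻¹' {x | ∃ ki : Fin N × Unit, x ki.1 ∈ P ki.1}) := by
    intro ω _
    by_contra hcon
    simp only [Set.mem_union, not_or] at hcon
    exact hcon.1 (hG ω (fun i hi => hcon.2.1 ⟨(i, ()), hi⟩) fun i hi => hcon.2.2 ⟨(i, ()), hi⟩)
  have h6 : (1 : ENNReal) ≤ μ G + (ENNReal.ofReal (δ / 2) + ENNReal.ofReal (δ / 2)) := by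
    rw [← measure_univ (μ := μ)]
    exact (measure_mono hcover).trans ((measure_union_le _ _).trans
      (add_le_add le_rfl ((measure_union_le _ _).trans (add_le_add h4 h5))))
  rw [← ENNReal.ofReal_add (by linarith) (by linarith), add_halves] at h6
  rw [ENNReal.ofReal_sub 1 hδ, ENNReal.ofReal_one]
  exact tsub_le_iff_right.2 h6

end DataLaw

/-! ### Correct classification -/

section Classification

variable {N H : ℕ} [NeZero H] {S : Fin N → Type u} {A : Fin N → Type v} [∀ i, Fintype (S i)]
  [∀ i, Fintype (A i)]

theorem caty_iff_mem_nearFeasible (M : ∀ i, MDP (S i) (A i) H) (πE : ∀ i, Policy (S i) (A i) H)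
    {τE : Fin N → ℕ} (D : ∀ i, Fin (τE i) → Hist (S i) (A i) H)
    (p : ∀ i, Fin H → S i → A i → S i → ℝ) {ε₀ ε Δ : ℝ} {U : Util H} (hU : U ∈ utilities H)
    (hε : 0 ≤ ε)
    (h : ∀ i, |catyEstimate ε₀ U (M i).s₀ (M i).r (D i) (p i) - noncompat U (M i) (πE i)| ≤ ε / N)
    (hΔ : U ∈ nearFeasible M πE (Δ - ε) ∨ U ∉ nearFeasible M πE (Δ + ε)) :
    Caty ε₀ Δ U (fun i => (M i).s₀) (fun i => (M i).r) D p ↔ U ∈ nearFeasible M πE Δ := by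
  have hsum : |∑ i, catyEstimate ε₀ U (M i).s₀ (M i).r (D i) (p i) -
      ∑ i, noncompat U (M i) (πE i)| ≤ ε := by
    rw [← Finset.sum_sub_distrib]
    refine (Finset.abs_sum_le_sum_abs _ _).trans ((Finset.sum_le_sum fun i _ => h i).trans ?_)
    rw [Finset.sum_const, Finset.card_univ, Fintype.card_fin, nsmul_eq_mul]
    rw [mul_div_assoc']
    exact div_le_of_le_mul₀ (Nat.cast_nonneg N) hε (mul_comm _ _).le
  rw [abs_le] at hsum
  simp only [nearFeasible, Set.mem_ofPred_eq, hU, true_and, not_le, Caty] at hΔ ⊢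
  rcases hΔ with hΔ | hΔ
  · exact ⟨fun _ => by linarith, fun _ => by linarith⟩
  · exact ⟨fun _ => by linarith, fun _ => by linarith⟩

end Classification

/-! ### Sample sizes -/

section SampleSizes

/-- The form in which logarithmic sample sizes are used: ten times the logarithm of `2 w` in the
exponent pays for `1024 a` events, when `a` is at most cubic in `w`. -/
theorem exp_neg_mul_le {a w δ e : ℝ} (hw : 1 ≤ w) (hδ : 0 ≤ δ) (ha : a ≤ w ^ 3 * δ)
    (he : 10 * Real.log (2 * w) ≤ e) : 1024 * a * Real.exp (-e) ≤ δ := by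
  have hw0 : 0 < w := by linarith
  have h1 : Real.exp (-e) ≤ ((2 * w) ^ 10)⁻¹ := by
    rw [← Real.exp_log (show (0 : ℝ) < (2 * w) ^ 10 by positivity), ← Real.exp_neg, Real.log_pow]
    exact Real.exp_le_exp.2 (by push_cast; linarith)
  have h2 : w ^ 3 ≤ w ^ 10 := pow_le_pow_right₀ hw (by norm_num)
  calc 1024 * a * Real.exp (-e) ≤ 1024 * (w ^ 3 * δ) * Real.exp (-e) :=
        mul_le_mul_of_nonneg_right (by linarith) (Real.exp_pos _).le
    _ ≤ 1024 * (w ^ 10 * δ) * ((2 * w) ^ 10)⁻¹ := by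
        refine mul_le_mul ?_ h1 (Real.exp_pos _).le (by positivity)
        linarith [mul_le_mul_of_nonneg_right h2 hδ]
    _ = δ := by
        field_simp
        ring

/-- Rounding down costs at most a factor of two. -/
theorem half_le_div {a : ℝ} {τ d : ℕ} (hd : 0 < d) (ha : 1 ≤ a) (h : a * d ≤ τ) :
    a / 2 ≤ (τ / d : ℕ) := by
  have hd' : (0 : ℝ) < d := by exact_mod_cast hd
  have h1 : (τ : ℝ) < d * ((τ / d : ℕ) + 1) := by exact_mod_cast Nat.lt_mul_div_succ τ hd
  have h2 : a < (τ / d : ℕ) + 1 := lt_of_mul_lt_mul_right (a := (d : ℝ)) (by linarith) hd'.le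
  have h3 : 0 < τ / d := by
    have : (0 : ℝ) < (τ / d : ℕ) := by linarith
    exact_mod_cast this
  have h4 : (1 : ℝ) ≤ (τ / d : ℕ) := by exact_mod_cast h3
  linarith

theorem half_lt_log {x : ℝ} (hx : 2 ≤ x) : 1 / 2 < Real.log x := by
  have := Real.log_two_gt_d9
  have := Real.log_le_log two_pos hx
  linarith

end SampleSizes

/-! ### Failure probabilities in one environment -/

section Environment

variable {N H : ℕ} [NeZero N] [NeZero H] {S : Type u} {A : Type v} [Fintype S] [Fintype A]
  {L ε δ ε₀ : ℝ} {U : Util H}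

theorem one_le_cast (n : ℕ) [NeZero n] : (1 : ℝ) ≤ n := by
  exact_mod_cast NeZero.one_le

/-- The exponent `ε / (16 N H²)` of the concentration inequalities is admissible, also for the
potential argument. -/
theorem exponent_mul_le (hε : ε ∈ Set.Ioo (0 : ℝ) 1) :
    ε / (16 * N * (H : ℝ) ^ 2) * H ≤ 1 / 16 := by
  have hN := one_le_cast N
  have hH := one_le_cast H
  rw [div_mul_eq_mul_div, div_le_iff₀ (by positivity)]
  have h1 : ε * H ≤ 1 * (H : ℝ) ^ 2 :=
    mul_le_mul hε.2.le (by nlinarith) (by linarith) zero_le_one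
  have h2 : 1 * (H : ℝ) ^ 2 ≤ N * (H : ℝ) ^ 2 := mul_le_mul_of_nonneg_right hN (sq_nonneg _)
  linarith

theorem gridWidth_pos (hL : 1 ≤ L) (hε : ε ∈ Set.Ioo (0 : ℝ) 1)
    (hε₀ : ε₀ = ε ^ 2 / (72 * H * L ^ 2 * (N : ℝ) ^ 2)) : 0 < ε₀ := by
  have hN := one_le_cast N
  have hH := one_le_cast H
  have := hε.1
  rw [hε₀]
  positivity

theorem lipschitz_mul_gridWidth_le (hL : 1 ≤ L) (hε : ε ∈ Set.Ioo (0 : ℝ) 1)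
    (hε₀ : ε₀ = ε ^ 2 / (72 * H * L ^ 2 * (N : ℝ) ^ 2)) : L * (H * ε₀) ≤ ε / (72 * N) := by
  have hN := one_le_cast N
  have hH := one_le_cast H
  have hε0 := hε.1
  have hL0 : 0 < L := by linarith
  have h1 : L * (H * ε₀) = ε / (72 * N) * (ε / (L * N)) := by
    rw [hε₀]
    field_simp
  rw [h1]
  refine mul_le_of_le_one_right (by positivity) ?_
  rw [div_le_one (by positivity)]
  nlinarith [hε.2]

theorem div_gridWidth (hL : 1 ≤ L) (hε : ε ∈ Set.Ioo (0 : ℝ) 1)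
    (hε₀ : ε₀ = ε ^ 2 / (72 * H * L ^ 2 * (N : ℝ) ^ 2)) :
    H / ε₀ = 72 * (H ^ 2 * L ^ 2 * N ^ 2 / ε ^ 2) := by
  have hN := one_le_cast N
  have hH := one_le_cast H
  have hε0 := hε.1
  have hL0 : 0 < L := by linarith
  rw [hε₀]
  field_simp

theorem lipschitz_mul_gridWidth_le' (hL : 1 ≤ L) (hε : ε ∈ Set.Ioo (0 : ℝ) 1)
    (hε₀ : ε₀ = ε ^ 2 / (72 * H * L ^ 2 * (N : ℝ) ^ 2)) : L * ε₀ ≤ ε / (72 * N) := by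
  have hH := one_le_cast H
  have h0 := gridWidth_pos hL hε hε₀
  refine le_trans ?_ (lipschitz_mul_gridWidth_le hL hε hε₀)
  exact mul_le_mul_of_nonneg_left (le_mul_of_one_le_left h0.le hH) (by linarith)

variable [MeasurableSpace S] [DiscreteMeasurableSpace S]

/-- The empirical transition model on the optimal value functions for one utility. The value
functions are needed only at accumulated rewards that are multiples of `ε₀`, of which there are at
most `H ⌊1 / ε₀⌋ + 1`. -/
theorem measure_exists_not_varClose_le [Nonempty S] [Nonempty A] (hL : 1 ≤ L)
    (hε : ε ∈ Set.Ioo (0 : ℝ) 1) (hδ : δ ∈ Set.Ioo (0 : ℝ) 1)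
    (hε₀ : ε₀ = ε ^ 2 / (72 * H * L ^ 2 * (N : ℝ) ^ 2)) (M : MDP S A H) (U : Util H) {n : ℕ}
    (hn : 2560 * ((N : ℝ) ^ 2 * (H : ℝ) ^ 3 / ε ^ 2 *
      Real.log (2 * Fintype.card S * Fintype.card A * H * N * L / (δ * ε))) ≤ n) :
    (Measure.pi fun x : Fin H × S × A =>
      Measure.pi fun _ : Fin n => (M.p x.1 x.2.1 x.2.2).toMeasure)
        {X | ∃ xm : (Fin H × S × A) × Fin (H * ⌊1 / ε₀⌋₊ + 1),
          ¬ VarClose (wt (M.p xm.1.1 xm.1.2.1 xm.1.2.2)) (empWt (X xm.1))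
            (ε / (16 * N * (H : ℝ) ^ 2)) (ε / (16 * N * H)) (H / 2) fun s' =>
              stageValue (fun h s a => wt (M.p h s a)) (discReward ε₀ M.r) U (Fin.rev xm.1.1)
                (Fin.rev xm.1.1).isLt.le s' (xm.2 * ε₀)} ≤
      ENNReal.ofReal (δ / (2 * N)) := by
  have hN := one_le_cast N
  have hH := one_le_cast H
  have hε0 := hε.1
  have hδ0 := hδ.1
  have hL0 : 0 < L := by linarith
  have hS : (1 : ℝ) ≤ Fintype.card S := by exact_mod_cast Fintype.card_pos
  have hA : (1 : ℝ) ≤ Fintype.card A := by exact_mod_cast Fintype.card_pos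
  refine (measure_pi_exists_le
    (fun x : Fin H × S × A => Measure.pi fun _ : Fin n => (M.p x.1 x.2.1 x.2.2).toMeasure)
    (fun x (m : Fin (H * ⌊1 / ε₀⌋₊ + 1)) X =>
      ¬ VarClose (wt (M.p x.1 x.2.1 x.2.2)) (empWt X)
        (ε / (16 * N * (H : ℝ) ^ 2)) (ε / (16 * N * H)) (H / 2) fun s' =>
          stageValue (fun h s a => wt (M.p h s a)) (discReward ε₀ M.r) U (Fin.rev x.1)
            (Fin.rev x.1).isLt.le s' (m * ε₀))
    fun x m => measure_not_varClose_le (M.p x.1 x.2.1 x.2.2) (B := H) (by linarith)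
      (fun s' => stageValue_mem_Icc (fun h s a => wt_mem_stdSimplex _) _ _ _ _) (by positivity)
      ((exponent_mul_le hε).trans (by norm_num)) n).trans (ENNReal.ofReal_le_ofReal ?_)
  set cS : ℝ := (Fintype.card S : ℝ) with hcS
  set cA : ℝ := (Fintype.card A : ℝ) with hcA
  set w := cS * cA * H * N * L / (δ * ε) with hwdef
  have hδε : δ * ε ≤ 1 := by nlinarith [hδ.2, hε.2]
  have hprod : 1 ≤ cS * cA * H * N * L := one_le_mul_of_one_le_of_one_le
    (one_le_mul_of_one_le_of_one_le (one_le_mul_of_one_le_of_one_le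
      (one_le_mul_of_one_le_of_one_le hS hA) hH) hN) hL
  have hw : 1 ≤ w := (one_le_div (by positivity)).2 (by linarith)
  have hw2 : 2 * cS * cA * H * N * L / (δ * ε) = 2 * w := by
    rw [hwdef]
    ring
  rw [hw2] at hn
  have hlog := half_lt_log (x := 2 * w) (by linarith)
  have he1 : 10 * Real.log (2 * w) ≤
      n * (ε / (16 * N * (H : ℝ) ^ 2) * (ε / (16 * N * H))) := by
    have h1 := mul_le_mul_of_nonneg_right hn
      (show 0 ≤ ε / (16 * N * (H : ℝ) ^ 2) * (ε / (16 * N * H)) by positivity)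
    refine le_trans (le_of_eq ?_) h1
    field_simp
    norm_num
  have he2 : 10 * Real.log (2 * w) ≤ n * (1 / (8 * (H : ℝ) ^ 2) * (H / 2)) := by
    refine he1.trans (mul_le_mul_of_nonneg_left ?_ (Nat.cast_nonneg n))
    have h1 : ε / (16 * N * (H : ℝ) ^ 2) * (ε / (16 * N * H)) =
        1 / (8 * (H : ℝ) ^ 2) * (H / 2) * ((ε / (4 * N * H)) ^ 2) := by
      field_simp
      norm_num
    rw [h1]
    refine mul_le_of_le_one_right (by positivity) (pow_le_one₀ (by positivity) ?_)
    rw [div_le_one (by positivity)]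
    nlinarith [hε.2]
  have ha : N * (H * (cS * cA)) * (H ^ 2 * L ^ 2 * N ^ 2 / ε ^ 2) ≤ w ^ 3 * δ := by
    have h1 : w ^ 3 * δ = N * (H * (cS * cA)) * (H ^ 2 * L ^ 2 * N ^ 2 / ε ^ 2) *
        ((cS * cA) ^ 2 * L / (δ ^ 2 * ε)) := by
      rw [hwdef]
      field_simp
    rw [h1]
    refine le_mul_of_one_le_right (by positivity) ((one_le_div (by positivity)).2 ?_)
    have h2 : δ ^ 2 * ε ≤ 1 := mul_le_one₀ (pow_le_one₀ hδ0.le hδ.2.le) hε0.le hε.2.le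
    have h3 : 1 ≤ (cS * cA) ^ 2 * L := one_le_mul_of_one_le_of_one_le
      (one_le_pow₀ (one_le_mul_of_one_le_of_one_le hS hA)) hL
    linarith
  have hf1 := exp_neg_mul_le hw hδ0.le ha he1
  have hf2 := exp_neg_mul_le hw hδ0.le ha he2
  have hcard1 : (Fintype.card (Fin H × S × A) : ℝ) = H * (cS * cA) := by
    simp [hcS, hcA]
  have hcard2 : (Fintype.card (Fin (H * ⌊1 / ε₀⌋₊ + 1)) : ℝ) ≤
      73 * (H ^ 2 * L ^ 2 * N ^ 2 / ε ^ 2) := by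
    have h1 : (⌊1 / ε₀⌋₊ : ℝ) ≤ 1 / ε₀ :=
      Nat.floor_le (div_nonneg zero_le_one (gridWidth_pos hL hε hε₀).le)
    have h2 : (H : ℝ) * ⌊1 / ε₀⌋₊ ≤ H / ε₀ := by
      have h3 := mul_le_mul_of_nonneg_left h1 (show (0 : ℝ) ≤ H by linarith)
      rwa [mul_one_div] at h3
    have h3 : 1 ≤ (H : ℝ) ^ 2 * L ^ 2 * N ^ 2 / ε ^ 2 := by
      rw [one_le_div (by positivity)]
      have h4 : ε ^ 2 ≤ 1 := pow_le_one₀ hε0.le hε.2.le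
      have h5 : 1 ≤ (H : ℝ) ^ 2 * L ^ 2 * N ^ 2 := one_le_mul_of_one_le_of_one_le
        (one_le_mul_of_one_le_of_one_le (one_le_pow₀ hH) (one_le_pow₀ hL)) (one_le_pow₀ hN)
      linarith
    rw [div_gridWidth hL hε hε₀] at h2
    rw [Fintype.card_fin]
    push_cast
    linarith
  rw [hcard1]
  set e1 := Real.exp (-(n * (ε / (16 * N * (H : ℝ) ^ 2) * (ε / (16 * N * H))))) with he1def
  set e2 := Real.exp (-(n * (1 / (8 * (H : ℝ) ^ 2) * (H / 2)))) with he2def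
  have he10 : 0 < e1 := Real.exp_pos _
  have he20 : 0 < e2 := Real.exp_pos _
  rw [le_div_iff₀ (by positivity)]
  set a := N * (H * (cS * cA)) * (H ^ 2 * L ^ 2 * N ^ 2 / ε ^ 2) with hadef
  have ha0 : 0 < a := by positivity
  calc H * (cS * cA) * Fintype.card (Fin (H * ⌊1 / ε₀⌋₊ + 1)) * (2 * e1 + e2) * (2 * N)
      ≤ H * (cS * cA) * (73 * (H ^ 2 * L ^ 2 * N ^ 2 / ε ^ 2)) * (2 * e1 + e2) * (2 * N) := by
        gcongr
    _ = 292 * (a * e1) + 146 * (a * e2) := by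
        rw [hadef]
        ring
    _ ≤ δ := by linarith [mul_pos ha0 he10, mul_pos ha0 he20]

/-- The empirical transition model on all events, which controls the planning error for all
utilities. -/
theorem measure_exists_sum_add_lt_le [Nonempty S] [Nonempty A]
    (hε : ε ∈ Set.Ioo (0 : ℝ) 1) (hδ : δ ∈ Set.Ioo (0 : ℝ) 1) (M : MDP S A H) {n : ℕ}
    (hn : 2560 * ((N : ℝ) ^ 2 * (H : ℝ) ^ 4 / ε ^ 2 * (Fintype.card S +
      Real.log (Fintype.card S * Fintype.card A * H * N / δ))) ≤ n) :
    (Measure.pi fun x : Fin H × S × A =>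
      Measure.pi fun _ : Fin n => (M.p x.1 x.2.1 x.2.2).toMeasure)
        {X | ∃ xT : (Fin H × S × A) × Finset S,
          ∑ s ∈ xT.2, wt (M.p xT.1.1 xT.1.2.1 xT.1.2.2) s + ε / (8 * N * (H : ℝ) ^ 2) <
            ∑ s ∈ xT.2, empWt (X xT.1) s} ≤
      ENNReal.ofReal (δ / (2 * N)) := by
  have hN := one_le_cast N
  have hH := one_le_cast H
  have hε0 := hε.1
  have hδ0 := hδ.1
  have hS : (1 : ℝ) ≤ Fintype.card S := by exact_mod_cast Fintype.card_pos
  have hA : (1 : ℝ) ≤ Fintype.card A := by exact_mod_cast Fintype.card_pos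
  have hθ1 : ε / (16 * N * (H : ℝ) ^ 2) ≤ 1 := by
    rw [div_le_one (by positivity)]
    have : 1 ≤ N * (H : ℝ) ^ 2 := one_le_mul_of_one_le_of_one_le hN (one_le_pow₀ hH)
    linarith [hε.2]
  refine (measure_pi_exists_le
    (fun x : Fin H × S × A => Measure.pi fun _ : Fin n => (M.p x.1 x.2.1 x.2.2).toMeasure)
    (fun x (T : Finset S) X => ∑ s ∈ T, wt (M.p x.1 x.2.1 x.2.2) s + ε / (8 * N * (H : ℝ) ^ 2) <
      ∑ s ∈ T, empWt X s)
    fun x T => measure_sum_add_lt_sum_le (M.p x.1 x.2.1 x.2.2) T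
      (θ := ε / (16 * N * (H : ℝ) ^ 2)) (t := ε / (16 * N * (H : ℝ) ^ 2)) (by positivity) hθ1
      (le_of_eq (by field_simp; norm_num)) n).trans (ENNReal.ofReal_le_ofReal ?_)
  rw [Fintype.card_finset]
  have hcard1 : (Fintype.card (Fin H × S × A) : ℝ) = H * (Fintype.card S * Fintype.card A) := by
    simp
  rw [hcard1]
  push_cast
  have hpow : (2 : ℝ) ^ Fintype.card S ≤ Real.exp (Fintype.card S) := by
    rw [← mul_one (Fintype.card S : ℝ), Real.exp_nat_mul]
    exact pow_le_pow_left₀ zero_le_two (by linarith [Real.add_one_le_exp 1]) _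
  set cS : ℝ := (Fintype.card S : ℝ) with hcS
  set cA : ℝ := (Fintype.card A : ℝ) with hcA
  set z := cS * cA * H * N / δ with hzdef
  have hprod : 1 ≤ cS * cA * H * N := one_le_mul_of_one_le_of_one_le
    (one_le_mul_of_one_le_of_one_le (one_le_mul_of_one_le_of_one_le hS hA) hH) hN
  have hz : 1 ≤ z := (one_le_div hδ0).2 (by linarith [hδ.2])
  have hlog : 0 ≤ Real.log z := Real.log_nonneg hz
  have he : 10 * (cS + Real.log z) ≤
      n * (ε / (16 * N * (H : ℝ) ^ 2) * (ε / (16 * N * (H : ℝ) ^ 2))) := by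
    have h1 := mul_le_mul_of_nonneg_right hn
      (show 0 ≤ ε / (16 * N * (H : ℝ) ^ 2) * (ε / (16 * N * (H : ℝ) ^ 2)) by positivity)
    refine le_trans (le_of_eq ?_) h1
    field_simp
    norm_num
  have he' : Real.exp (-(n * (ε / (16 * N * (H : ℝ) ^ 2) * (ε / (16 * N * (H : ℝ) ^ 2))))) ≤
      Real.exp (-cS) * (Real.exp (-1) * z⁻¹) := by
    have h1 : z⁻¹ = Real.exp (-Real.log z) := by
      rw [Real.exp_neg, Real.exp_log (by linarith)]
    rw [h1, ← Real.exp_add, ← Real.exp_add]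
    exact Real.exp_le_exp.2 (by linarith)
  have hexp1 : Real.exp (-1) ≤ 1 / 2 := by
    rw [Real.exp_neg, inv_le_comm₀ (Real.exp_pos 1) (by norm_num)]
    linarith [Real.add_one_le_exp 1]
  calc H * (cS * cA) * 2 ^ Fintype.card S *
        Real.exp (-(n * (ε / (16 * N * (H : ℝ) ^ 2) * (ε / (16 * N * (H : ℝ) ^ 2)))))
      ≤ H * (cS * cA) * Real.exp cS * (Real.exp (-cS) * (1 / 2 * z⁻¹)) := by
        gcongr
        refine he'.trans ?_
        gcongr
    _ = H * (cS * cA) * (Real.exp cS * Real.exp (-cS)) * (1 / 2 * z⁻¹) := by ring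
    _ = δ / (2 * N) := by
        rw [← Real.exp_add, add_neg_cancel, Real.exp_zero, hzdef]
        field_simp

variable [MeasurableSpace A] [DiscreteMeasurableSpace A]

/-- The expert's expected utility, for one utility. -/
theorem measure_lt_abs_empWt_sub_perf_le (hε : ε ∈ Set.Ioo (0 : ℝ) 1) (hδ : δ ∈ Set.Ioo (0 : ℝ) 1)
    (M : MDP S A H) (π : Policy S A H) (U : Util H) {τ : ℕ}
    (hτ : 5120 * ((N : ℝ) ^ 2 * (H : ℝ) ^ 2 / ε ^ 2 * Real.log (2 * N / δ)) ≤ τ) :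
    (Measure.pi fun _ : Fin τ => (trajLaw M π).toMeasure)
        {D | ε / (8 * N) < |expect (empWt D) (fun ω => U.eval (ret M.r ω)) - perf U M π|} ≤
      ENNReal.ofReal (δ / (2 * N)) := by
  have hN := one_le_cast N
  have hH := one_le_cast H
  have hε0 := hε.1
  have hδ0 := hδ.1
  refine (measure_lt_abs_sub_le (trajLaw M π) (B := H) (θ := ε / (16 * N * (H : ℝ) ^ 2))
    (t := ε / (16 * N)) (fun ω => U.eval_mem_Icc _) (by positivity)
    ((exponent_mul_le hε).trans (by norm_num)) (le_of_eq (by field_simp; norm_num)) τ).trans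
    (ENNReal.ofReal_le_ofReal ?_)
  have hw : 1 ≤ N / δ := (one_le_div hδ0).2 (by linarith [hδ.2])
  have hlog := half_lt_log (x := 2 * (N / δ)) (by linarith)
  have he : 10 * Real.log (2 * (N / δ)) ≤ τ * (ε / (16 * N * (H : ℝ) ^ 2) * (ε / (16 * N))) := by
    have h1 := mul_le_mul_of_nonneg_right hτ
      (show 0 ≤ ε / (16 * N * (H : ℝ) ^ 2) * (ε / (16 * N)) by positivity)
    have h2 : 5120 * ((N : ℝ) ^ 2 * (H : ℝ) ^ 2 / ε ^ 2 * Real.log (2 * N / δ)) *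
        (ε / (16 * N * (H : ℝ) ^ 2) * (ε / (16 * N))) = 20 * Real.log (2 * (N / δ)) := by
      rw [← mul_div_assoc 2 (N : ℝ) δ]
      field_simp
      ring
    linarith
  have ha : (N : ℝ) ≤ (N / δ) ^ 3 * δ := by
    have h1 : (N : ℝ) = N / δ * δ := by field_simp
    have h2 : N / δ ≤ (N / δ) ^ 3 := le_self_pow₀ hw (by norm_num)
    calc (N : ℝ) = N / δ * δ := h1
      _ ≤ _ := mul_le_mul_of_nonneg_right h2 hδ0.le
  have h := exp_neg_mul_le hw hδ0.le ha he
  rw [le_div_iff₀ (by positivity)]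
  have h3 : 0 ≤ N * Real.exp (-(τ * (ε / (16 * N * (H : ℝ) ^ 2) * (ε / (16 * N))))) := by positivity
  linarith

/-- The expert's return distribution at the positive grid points, which controls the expected
utility for all utilities. -/
theorem measure_exists_lt_abs_empWt_sub_le (hL : 1 ≤ L) (hε : ε ∈ Set.Ioo (0 : ℝ) 1)
    (hδ : δ ∈ Set.Ioo (0 : ℝ) 1) (hε₀ : ε₀ = ε ^ 2 / (72 * H * L ^ 2 * (N : ℝ) ^ 2))
    (M : MDP S A H) (π : Policy S A H) {τ : ℕ}
    (hτ : 5120 * ((N : ℝ) ^ 4 * (H : ℝ) ^ 4 * L ^ 2 / ε ^ 4 *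
      Real.log (2 * H * N * L / (δ * ε))) ≤ τ) :
    (Measure.pi fun _ : Fin τ => (trajLaw M π).toMeasure)
        {D | ∃ k : Fin ⌊(H : ℝ) / ε₀⌋₊, ε / (8 * N * H) <
          |expect (empWt D) (fun ω => if ((k + 1 : ℕ) : ℝ) * ε₀ ≤ ret M.r ω then 1 else 0) -
            expect (wt (trajLaw M π))
              (fun ω => if ((k + 1 : ℕ) : ℝ) * ε₀ ≤ ret M.r ω then 1 else 0)|} ≤
      ENNReal.ofReal (δ / (2 * N)) := by
  have hN := one_le_cast N
  have hH := one_le_cast H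
  have hε0 := hε.1
  have hδ0 := hδ.1
  have hL0 : 0 < L := by linarith
  have hθ1 : ε / (16 * N * H) * 1 ≤ 1 := by
    rw [mul_one, div_le_one (by positivity)]
    nlinarith [hε.2]
  refine (measure_exists_le _ (fun (k : Fin ⌊(H : ℝ) / ε₀⌋₊) (D : Fin τ → Hist S A H) =>
    ε / (8 * N * H) <
      |expect (empWt D) (fun ω => if ((k + 1 : ℕ) : ℝ) * ε₀ ≤ ret M.r ω then 1 else 0) -
        expect (wt (trajLaw M π))
          (fun ω => if ((k + 1 : ℕ) : ℝ) * ε₀ ≤ ret M.r ω then 1 else 0)|) fun k =>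
      measure_lt_abs_sub_le (trajLaw M π) (B := 1) (θ := ε / (16 * N * H))
    (t := ε / (16 * N * H)) (fun ω => by split_ifs <;> simp) (by positivity)
    hθ1 (le_of_eq (by field_simp; norm_num)) τ).trans (ENNReal.ofReal_le_ofReal ?_)
  set w := H * N * L / (δ * ε) with hwdef
  have hδε : δ * ε ≤ 1 := by nlinarith [hδ.2, hε.2]
  have hHNL : 1 ≤ H * N * L := one_le_mul_of_one_le_of_one_le
    (one_le_mul_of_one_le_of_one_le hH hN) hL
  have hw : 1 ≤ w := (one_le_div (by positivity)).2 (by linarith)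
  have hw2 : 2 * H * N * L / (δ * ε) = 2 * w := by
    rw [hwdef]
    ring
  have hlog := half_lt_log (x := 2 * w) (by linarith)
  have he : 10 * Real.log (2 * w) ≤ τ * (ε / (16 * N * H) * (ε / (16 * N * H))) := by
    rw [hw2] at hτ
    have h1 := mul_le_mul_of_nonneg_right hτ
      (show 0 ≤ ε / (16 * N * H) * (ε / (16 * N * H)) by positivity)
    have h2 : 5120 * ((N : ℝ) ^ 4 * (H : ℝ) ^ 4 * L ^ 2 / ε ^ 4 * Real.log (2 * w)) *
        (ε / (16 * N * H) * (ε / (16 * N * H))) =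
          20 * Real.log (2 * w) * (N * H * L / ε) ^ 2 := by
      field_simp
      norm_num
    have h3 : 1 ≤ (N * H * L / ε) ^ 2 :=
      one_le_pow₀ ((one_le_div hε0).2 (by linarith [hε.2]))
    have h4 : 20 * Real.log (2 * w) * 1 ≤ 20 * Real.log (2 * w) * (N * H * L / ε) ^ 2 :=
      mul_le_mul_of_nonneg_left h3 (by linarith)
    linarith
  have ha : N * (H ^ 2 * L ^ 2 * N ^ 2 / ε ^ 2) ≤ w ^ 3 * δ := by
    have h1 : w ^ 3 * δ = N * (H ^ 2 * L ^ 2 * N ^ 2 / ε ^ 2) * (H * L / (δ ^ 2 * ε)) := by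
      rw [hwdef]
      field_simp
    rw [h1]
    refine le_mul_of_one_le_right (by positivity) ((one_le_div (by positivity)).2 ?_)
    have h2 : δ ^ 2 * ε ≤ 1 := mul_le_one₀ (pow_le_one₀ hδ0.le hδ.2.le) hε0.le hε.2.le
    nlinarith
  have h := exp_neg_mul_le hw hδ0.le ha he
  have hcard : (Fintype.card (Fin ⌊(H : ℝ) / ε₀⌋₊) : ℝ) ≤
      72 * (H ^ 2 * L ^ 2 * N ^ 2 / ε ^ 2) := by
    rw [Fintype.card_fin, ← div_gridWidth hL hε hε₀]
    exact Nat.floor_le (div_nonneg (by linarith) (gridWidth_pos hL hε hε₀).le)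
  set e := Real.exp (-(τ * (ε / (16 * N * H) * (ε / (16 * N * H))))) with hedef
  have he0 : 0 < e := Real.exp_pos _
  rw [le_div_iff₀ (by positivity)]
  calc Fintype.card (Fin ⌊(H : ℝ) / ε₀⌋₊) * (2 * e) * (2 * N)
      ≤ 72 * (H ^ 2 * L ^ 2 * N ^ 2 / ε ^ 2) * (2 * e) * (2 * N) := by gcongr
    _ = 288 * (N * (H ^ 2 * L ^ 2 * N ^ 2 / ε ^ 2)) * e := by ring
    _ ≤ 1024 * (N * (H ^ 2 * L ^ 2 * N ^ 2 / ε ^ 2)) * e := by gcongr; norm_num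
    _ ≤ δ := h

end Environment

/-! ### Accuracy of the estimates -/

section Accuracy

variable {N H : ℕ} [NeZero N] [NeZero H] {S : Type u} {A : Type v} [Fintype S] [Fintype A]
  {L ε ε₀ : ℝ} {U : Util H}

/-- If the expert's performance and the optimal performance are both estimated well, then so is
the noncompatibility. -/
theorem abs_catyEstimate_sub_noncompat_le (M : MDP S A H) (π : Policy S A H) (hL : 1 ≤ L)
    (hU : U ∈ lipUtilities H L) (hε : ε ∈ Set.Ioo (0 : ℝ) 1)
    (hε₀ : ε₀ = ε ^ 2 / (72 * H * L ^ 2 * (N : ℝ) ^ 2)) {τ : ℕ} (hτ : 0 < τ)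
    (D : Fin τ → Hist S A H) (p : Fin H → S → A → S → ℝ)
    (hexpert : |expect (empWt D) (fun ω => U.eval (ret M.r ω)) - perf U M π| ≤
      2 * (L * ε₀) + ε / (8 * N))
    (hplan : |planning M.s₀ p (discReward ε₀ M.r) U - optPerf U M| ≤
      ε / (4 * N) + L * (H * ε₀)) :
    |catyEstimate ε₀ U M.s₀ M.r D p - noncompat U M π| ≤ ε / N := by
  have hN := one_le_cast N
  have h1 := abs_sum_erd_sub_le (gridWidth_pos hL hε hε₀) (by linarith) hU M hτ D
  have h2 := lipschitz_mul_gridWidth_le hL hε hε₀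
  have h3 := lipschitz_mul_gridWidth_le' hL hε hε₀
  have h4 : ε / (72 * N) = 1 / 72 * (ε / N) := by field_simp
  have h5 : ε / (8 * N) = 1 / 8 * (ε / N) := by field_simp
  have h6 : ε / (4 * N) = 1 / 4 * (ε / N) := by field_simp
  have h7 : 0 < ε / N := div_pos hε.1 (by linarith)
  rw [catyEstimate, noncompat]
  rw [h4] at h2 h3
  rw [h5] at hexpert
  rw [h6] at hplan
  rw [abs_le] at h1 hexpert hplan ⊢
  constructor <;> linarith

theorem le_sampleSize {x : ℝ} {τ d : ℕ} (hd : 0 < d) (hx : 1 / 2 ≤ x)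
    (h : 5120 * (x * d) ≤ τ) : 2560 * x ≤ (τ / d : ℕ) ∧ 0 < τ / d := by
  have h1 := half_le_div hd (a := 5120 * x) (by linarith) (by linarith)
  exact ⟨by linarith, by exact_mod_cast (by linarith : (0 : ℝ) < (τ / d : ℕ))⟩

end Accuracy

end UtilityLearning

open UtilityLearning

theorem mainTheorem1 :
    ∃ C : ℝ, 0 < C ∧
      ∀ (N H : ℕ) [NeZero N] [NeZero H] (S : Fin N → Type u) (A : Fin N → Type v)
        [∀ i, Fintype (S i)] [∀ i, Fintype (A i)]
        [∀ i, MeasurableSpace (S i)] [∀ i, DiscreteMeasurableSpace (S i)]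
        [∀ i, MeasurableSpace (A i)] [∀ i, DiscreteMeasurableSpace (A i)]
        (M : ∀ i, MDP (S i) (A i) H) (πE : ∀ i, Policy (S i) (A i) H)
        (L ε δ : ℝ) (_ : 0 < L) (_ : ε ∈ Set.Ioo (0 : ℝ) 1) (_ : δ ∈ Set.Ioo (0 : ℝ) 1)
        (𝒰 : Set (Util H)) (_ : 𝒰 ⊆ lipUtilities H L)
        (τE τ : Fin N → ℕ)
        (_ : 𝒰.encard = 1 → ∀ i,
          C * ((N : ℝ) ^ 2 * (H : ℝ) ^ 2 / ε ^ 2 * Real.log (2 * N / δ)) ≤ τE i ∧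
          C * ((N : ℝ) ^ 2 * Fintype.card (S i) * Fintype.card (A i) * (H : ℝ) ^ 4 / ε ^ 2 *
            Real.log (2 * Fintype.card (S i) * Fintype.card (A i) * H * N * L / (δ * ε))) ≤ τ i)
        (_ : 𝒰.encard ≠ 1 → ∀ i,
          C * ((N : ℝ) ^ 4 * (H : ℝ) ^ 4 * L ^ 2 / ε ^ 4 *
            Real.log (2 * H * N * L / (δ * ε))) ≤ τE i ∧
          C * ((N : ℝ) ^ 2 * Fintype.card (S i) * Fintype.card (A i) * (H : ℝ) ^ 5 / ε ^ 2 *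
            (Fintype.card (S i) +
              Real.log (Fintype.card (S i) * Fintype.card (A i) * H * N / δ))) ≤ τ i)
        (ε₀ : ℝ) (_ : ε₀ = ε ^ 2 / (72 * H * L ^ 2 * (N : ℝ) ^ 2)),
        ENNReal.ofReal (1 - δ) ≤
          dataLaw M πE τE (perTriple H S A τ)
            {ω | ∀ Δ : ℝ, 0 ≤ Δ → ∀ U ∈ 𝒰,
              (U ∈ nearFeasible M πE (Δ - ε) ∨ U ∉ nearFeasible M πE (Δ + ε)) →
                (Caty ε₀ Δ U (fun i => (M i).s₀) (fun i => (M i).r) ω.1 (fun i => explore (ω.2 i)) ↔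
                  U ∈ nearFeasible M πE Δ)} := by
  -- `5120 = 2 * 256 * 10`: a factor two for rounding the sample sizes down, `256 = 16 ^ 2` from the
  -- denominators of the exponent and of the deviation, and ten logarithms for the union bound
  refine ⟨5120, by norm_num, ?_⟩
  intro N H _ _ S A _ _ _ _ _ _ M πE L ε δ hL0 hε hδ 𝒰 h𝒰 τE τ hone hmany ε₀ hε₀
  -- `1 ≤ L` is available only if there is a utility in the set
  rcases 𝒰.eq_empty_or_nonempty with rfl | ⟨U₀, hU₀⟩
  · refine ofReal_one_sub_le_dataLaw M πE τE _ hδ.1.le _ (fun _ => ∅) (fun _ => ∅) (by simp)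
      (by simp) ?_
    intro ω _ _ Δ _ U hU
    exact absurd hU (Set.notMem_empty U)
  have hL := one_le_of_mem_lipUtilities hL0.le (h𝒰 hU₀)
  have hSn : ∀ i, Nonempty (S i) := fun i => ⟨(M i).s₀⟩
  have hAn : ∀ i, Nonempty (A i) := fun i =>
    ⟨πE i ⟨0, NeZero.pos H⟩ (fun j => j.elim0, (M i).s₀)⟩
  have hN := one_le_cast N
  have hH := one_le_cast H
  have hε0 := hε.1
  have hδ0 := hδ.1
  have hε₀pos := gridWidth_pos hL hε hε₀
  have hS : ∀ i, (1 : ℝ) ≤ Fintype.card (S i) := fun i => by exact_mod_cast Fintype.card_pos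
  have hA : ∀ i, (1 : ℝ) ≤ Fintype.card (A i) := fun i => by exact_mod_cast Fintype.card_pos
  have hd : ∀ i, 0 < Fintype.card (S i) * Fintype.card (A i) * H := fun i =>
    Nat.mul_pos (Nat.mul_pos Fintype.card_pos Fintype.card_pos) (NeZero.pos H)
  have hδε : δ * ε ≤ 1 := mul_le_one₀ hδ.2.le hε0.le hε.2.le
  have hεsq : ε ^ 2 ≤ 1 := pow_le_one₀ hε0.le hε.2.le
  have hHN : 1 ≤ (H : ℝ) * N := one_le_mul_of_one_le_of_one_le hH hN
  by_cases hcard : 𝒰.encard = 1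
  · obtain ⟨U, rfl⟩ := Set.encard_eq_one.1 hcard
    have hUL : U ∈ lipUtilities H L := h𝒰 rfl
    have hτE : ∀ i, 0 < τE i := fun i => by
      have hl := half_lt_log (x := 2 * N / δ) ((le_div_iff₀ hδ0).2 (by linarith [hδ.2]))
      have h1 : 0 < (N : ℝ) ^ 2 * (H : ℝ) ^ 2 / ε ^ 2 * Real.log (2 * N / δ) := by positivity
      have h2 := (hone hcard i).1
      exact_mod_cast (by linarith : (0 : ℝ) < τE i)
    have hn : ∀ i, 2560 * ((N : ℝ) ^ 2 * (H : ℝ) ^ 3 / ε ^ 2 *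
        Real.log (2 * Fintype.card (S i) * Fintype.card (A i) * H * N * L / (δ * ε))) ≤
          perTriple H S A τ i ∧ 0 < perTriple H S A τ i := fun i => by
      have h1 : 1 ≤ (Fintype.card (S i) : ℝ) * Fintype.card (A i) * (H * N) * L :=
        one_le_mul_of_one_le_of_one_le (one_le_mul_of_one_le_of_one_le
          (one_le_mul_of_one_le_of_one_le (hS i) (hA i)) hHN) hL
      have hl := half_lt_log
        (x := 2 * Fintype.card (S i) * Fintype.card (A i) * H * N * L / (δ * ε))
        ((le_div_iff₀ (by positivity)).2 (by linarith))
      have h2 : 1 ≤ (N : ℝ) ^ 2 * (H : ℝ) ^ 3 / ε ^ 2 := by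
        rw [one_le_div (by positivity)]
        exact hεsq.trans (one_le_mul_of_one_le_of_one_le (one_le_pow₀ hN) (one_le_pow₀ hH))
      refine le_sampleSize (hd i) ?_ (le_trans (le_of_eq ?_) (hone hcard i).2)
      · nlinarith
      · push_cast
        ring
    refine ofReal_one_sub_le_dataLaw M πE τE (perTriple H S A τ) hδ0.le _ _ _
      (fun i => measure_lt_abs_empWt_sub_perf_le hε hδ (M i) (πE i) U (hone hcard i).1)
      (fun i => measure_exists_not_varClose_le hL hε hδ hε₀ (M i) U (hn i).1) ?_
    intro ω hE hP Δ _ U' hU'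
    obtain rfl : U' = U := hU'
    refine caty_iff_mem_nearFeasible M πE ω.1 _ hUL.1 hε0.le fun i => ?_
    have h1 := hE i
    have h2 := hP i
    simp only [Set.mem_ofPred_eq, not_lt, not_exists, not_not] at h1 h2
    refine abs_catyEstimate_sub_noncompat_le (M i) (πE i) hL hUL hε hε₀ (hτE i) (ω.1 i) _
      (h1.trans (le_add_of_nonneg_left (by positivity))) ?_
    refine (abs_planning_sub_optPerf_le_of_varClose hε₀pos hL0.le hUL (M i) (hn i).2 (ω.2 i)
      (θ := ε / (16 * N * (H : ℝ) ^ 2)) (t := ε / (16 * N * H)) (t' := H / 2) (by positivity)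
      (by linarith [exponent_mul_le (N := N) (H := H) hε]) ?_).trans
      (add_le_add (le_of_eq ?_) le_rfl)
    · intro j s a m hm
      have h3 := h2 ((Fin.rev j, s, a), ⟨m, Finset.mem_range.1 hm⟩)
      simp only [Fin.rev_rev] at h3
      exact h3
    · field_simp
      norm_num
  · have hτE : ∀ i, 0 < τE i := fun i => by
      have h1 : 1 ≤ (H : ℝ) * N * L := one_le_mul_of_one_le_of_one_le hHN hL
      have hl := half_lt_log (x := 2 * H * N * L / (δ * ε))
        ((le_div_iff₀ (by positivity)).2 (by linarith))
      have h1 : 0 < (N : ℝ) ^ 4 * (H : ℝ) ^ 4 * L ^ 2 / ε ^ 4 *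
        Real.log (2 * H * N * L / (δ * ε)) := by positivity
      have h2 := (hmany hcard i).1
      exact_mod_cast (by linarith : (0 : ℝ) < τE i)
    have hn : ∀ i, 2560 * ((N : ℝ) ^ 2 * (H : ℝ) ^ 4 / ε ^ 2 * (Fintype.card (S i) +
        Real.log (Fintype.card (S i) * Fintype.card (A i) * H * N / δ))) ≤
          perTriple H S A τ i ∧ 0 < perTriple H S A τ i := fun i => by
      have h1 : 1 ≤ (Fintype.card (S i) : ℝ) * Fintype.card (A i) * H * N :=
        one_le_mul_of_one_le_of_one_le (one_le_mul_of_one_le_of_one_le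
          (one_le_mul_of_one_le_of_one_le (hS i) (hA i)) hH) hN
      have hl := Real.log_nonneg
        (x := Fintype.card (S i) * Fintype.card (A i) * H * N / δ)
        ((one_le_div hδ0).2 (by linarith [hδ.2]))
      have h2 : 1 ≤ (N : ℝ) ^ 2 * (H : ℝ) ^ 4 / ε ^ 2 := by
        rw [one_le_div (by positivity)]
        exact hεsq.trans (one_le_mul_of_one_le_of_one_le (one_le_pow₀ hN) (one_le_pow₀ hH))
      refine le_sampleSize (hd i) ?_ (le_trans (le_of_eq ?_) (hmany hcard i).2)
      · nlinarith [hS i]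
      · push_cast
        ring
    refine ofReal_one_sub_le_dataLaw M πE τE (perTriple H S A τ) hδ0.le _ _ _
      (fun i => measure_exists_lt_abs_empWt_sub_le hL hε hδ hε₀ (M i) (πE i) (hmany hcard i).1)
      (fun i => measure_exists_sum_add_lt_le hε hδ (M i) (hn i).1) ?_
    intro ω hE hP Δ _ U hU
    have hUL : U ∈ lipUtilities H L := h𝒰 hU
    refine caty_iff_mem_nearFeasible M πE ω.1 _ hUL.1 hε0.le fun i => ?_
    have h1 := hE i
    have h2 := hP i
    simp only [Set.mem_ofPred_eq, not_lt, not_exists] at h1 h2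
    refine abs_catyEstimate_sub_noncompat_le (M i) (πE i) hL hUL hε hε₀ (hτE i) (ω.1 i) _ ?_ ?_
    · refine (abs_expect_eval_sub_le (wt_mem_stdSimplex _) (empWt_mem_stdSimplex (hτE i) _)
        (ret_mem_Icc (M i)) hε₀pos hL0.le hUL (β := ε / (8 * N * H)) (by positivity)
        fun k hk => h1 ⟨k, hk⟩).trans (add_le_add le_rfl (le_of_eq ?_))
      field_simp
    · refine (abs_planning_sub_optPerf_le_of_sum_le hε₀pos hL0.le hUL (M i) (hn i).2 (ω.2 i)
        (β := ε / (8 * N * (H : ℝ) ^ 2)) fun h s a T => h2 ((h, s, a), T)).trans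
        (add_le_add ?_ le_rfl)
      have h3 : (H : ℝ) * (H * (ε / (8 * N * (H : ℝ) ^ 2))) = 1 / 2 * (ε / (4 * N)) := by
        field_simp
        norm_num
      have h4 : 0 < ε / (4 * N) := by positivity
      linarith
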